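/- **Model.** There are $n$ agents, which are points of $\mathbb{R}^2$; each carries a light whose color belongs to a fixed finite set $C$ and persists until it is reset. Two agents see each other if and only if the segment between them contains no other agent. A configuration is obstruction-free if all agents see each other. Time is a sequence of rounds $t=0,1,2,\dots$; in each round an adversary activates a set of agents, subject only to each agent being activated infinitely often (semi-synchronous scheduler, SSYNC). An activated agent takes a snapshot, namely the set of positions and colors of the agents it sees (itself included), expressed in a Cartesian coordinate system centered at itself whose unit of length, axes and handedness are chosen by the adversary anew at each activation. From its own color and this snapshot alone it computes, by a deterministic algorithm that is the same for all agents, a destination and a new color; it takes this color and moves along the segment to the destination. All of this takes place within the round. The adversary may stop the move early, but only after the agent has covered a distance of at least $\delta$, where $\delta>0$ is fixed but unknown to the agents. Initially the agents are at arbitrary distinct points and all have the same color *black*. A corner is an extreme point of the convex hull of the positions of all agents. **Theorem.** With a set $C$ of five colors (*black* included) there are a color $red \neq black$ and an algorithm, neither depending on $n$, on $\delta$ or on the initial configuration, such that an agent whose color is *red*, whatever it sees, neither moves nor changes its color, and such that, for every $n$, every $\delta>0$, every initial configuration of $n$ black agents at distinct points, and all choices of the adversary: 1. no two agents are ever at the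 same point at the same time $t$; 2. there is a time $T$ from which on all agents are *red*, no agent moves, every agent is at a corner of the convex hull of the agents, and the configuration is obstruction-free; 3. (detection of global termination) if at some time a *red* agent sees only *red* agents, then all agents are *red* at that time. -/

import Mathlib

/-- The Euclidean plane. -/
abbrev Plane : Type := EuclideanSpace ℝ (Fin 2)

/-- A local coordinate system up to the choice of its origin, which is always the current position
of the agent using it: a positive unit of length together with a linear isometry of the plane,
which may reverse the orientation (no agreement on unit of measure, directions or chirality). -/
structure Frame where
  scale : ℝ
  scale_pos : 0 < scale
  isom : Plane ≃ₗᵢ[ℝ] Plane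

/-- Local coordinates, for an agent located at `o`, of the point with global coordinates `p`. -/
noncomputable def Frame.toLocal (F : Frame) (o p : Plane) : Plane :=
  F.scale • F.isom (p - o)

/-- Global coordinates of the point which has local coordinates `q` for an agent located at `o`. -/
noncomputable def Frame.toGlobal (F : Frame) (o q : Plane) : Plane :=
  o + F.isom.symm (F.scale⁻¹ • q)

theorem Frame.toGlobal_toLocal (F : Frame) (o p : Plane) :
    F.toGlobal o (F.toLocal o p) = p := by
  have h : F.scale ≠ 0 := F.scale_pos.ne'
  simp [Frame.toGlobal, Frame.toLocal, smul_smul, h]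

theorem Frame.toLocal_toGlobal (F : Frame) (o q : Plane) :
    F.toLocal o (F.toGlobal o q) = q := by
  have h : F.scale ≠ 0 := F.scale_pos.ne'
  simp [Frame.toGlobal, Frame.toLocal, smul_smul, h]

/-- A deterministic algorithm for anonymous oblivious agents with lights in the color set `C`.
Its input is the current color of the agent and its snapshot: the set of positions, in local
coordinates centered at the agent, and colors of the visible agents, itself included. It returns a
destination, in the same local coordinates, and a new color. It receives neither an identity,
nor the number of agents, nor anything remembered from earlier activations except the color. -/
abbrev Algorithm (C : Type) : Type := C → Set (Plane × C) → Plane × C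

/-- Agents `i` and `j` see each other when the segment joining them contains no other agent. -/
def Visible {n : ℕ} (x : Fin n → Plane) (i j : Fin n) : Prop :=
  ∀ k : Fin n, k ≠ i → k ≠ j → x k ∉ segment ℝ (x i) (x j)

/-- All agents see each other. -/
def ObstructionFree {n : ℕ} (x : Fin n → Plane) : Prop :=
  ∀ i j : Fin n, Visible x i j

/-- Agent `i` is located at a corner of the convex hull of the positions of all the agents. -/
def AtCorner {n : ℕ} (x : Fin n → Plane) (i : Fin n) : Prop :=
  x i ∈ (convexHull ℝ (Set.range x)).extremePoints ℝ

/-- The local view of agent `i`, expressed in the frame `F` centered at `i`. -/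
def localView {C : Type} {n : ℕ} (x : Fin n → Plane) (c : Fin n → C) (F : Frame) (i : Fin n) :
    Set (Plane × C) :=
  {p | ∃ j : Fin n, Visible x i j ∧ p = (F.toLocal (x i) (x j), c j)}

/-- `y` is a possible final position of a non-rigid move from `x` towards `d`: the move goes along
the segment from `x` to `d`, and it either reaches `d` or covers a distance at least `δ`. -/
def NonRigidMove (δ : ℝ) (x d y : Plane) : Prop :=
  y ∈ segment ℝ x d ∧ (y = d ∨ δ ≤ dist x y)

/-- An execution of the algorithm `A` by `n` agents under the semi-synchronous scheduler, from an
initial configuration with distinct positions in which every agent has color `black`. The adversary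
chooses the initial positions, the set of agents activated in each round (fairly), the frame used
in each activation, and the point where each move is stopped. -/
structure SSYNCExecution {C : Type} (A : Algorithm C) (black : C) (n : ℕ) (δ : ℝ) where
  pos : ℕ → Fin n → Plane
  col : ℕ → Fin n → C
  active : ℕ → Set (Fin n)
  frame : ℕ → Fin n → Frame
  init_pos : Function.Injective (pos 0)
  init_col : ∀ i, col 0 i = black
  fair : ∀ (i : Fin n) (t : ℕ), ∃ s, t ≤ s ∧ i ∈ active s
  idle_pos : ∀ (t : ℕ) (i : Fin n), i ∉ active t → pos (t + 1) i = pos t i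
  idle_col : ∀ (t : ℕ) (i : Fin n), i ∉ active t → col (t + 1) i = col t i
  step_col : ∀ (t : ℕ) (i : Fin n), i ∈ active t →
    col (t + 1) i = (A (col t i) (localView (pos t) (col t) (frame t i) i)).2
  step_pos : ∀ (t : ℕ) (i : Fin n), i ∈ active t →
    NonRigidMove δ (pos t i)
      ((frame t i).toGlobal (pos t i)
        (A (col t i) (localView (pos t) (col t) (frame t i) i)).1)
      (pos (t + 1) i)

/-! Every agent is turned into a corner, and lights certify it. Hidden agents lie on rays towards
visible ones, so an agent learns from its view whether it is a corner; it then becomes green. A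
green corner with an unlit boundary neighbor slides a little along its other edge, which makes that
neighbor a corner. An interior agent walks perpendicularly towards a nearest edge with lit ends,
provided that no unlit agent is closer to this edge. In a collinear configuration the inner agents
step off the line. A green agent that sees only lit agents becomes red: lit agents are corners and
corners never obstruct, so it sees everybody.

Safety: corners remain corners (`Step.corner`), and in a non-collinear configuration two agents that
are not corners never approach each other (`dist_le_of_displacement`). This excludes collisions.

Progress: the set of corners only grows, so it is eventually constant and all of it is lit. Suppose
that some agent stays outside. Then nobody is red (`forall_lit_of_red`). A collinear configuration,
or a non-corner on the boundary, would eventually yield a new corner; hence all non-corners are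
interior, corners rest, and no drop is completed, so every move has length at least `δ`. The sum of
squared distances between non-corners is monotone and bounded, and gains `δ ^ 2` whenever one of
them moves while another rests. Eventually, therefore, they move all together or not at all. The
agent nearest to the boundary then stays nearest until it moves, and its move lowers the minimal
distance by `δ`. This cannot be repeated forever (`StableRun.forall_mem`). -/

/-! ### Plane vectors in coordinates -/

/-- The scalar product, in coordinates. -/
def dot (a b : Plane) : ℝ := a 0 * b 0 + a 1 * b 1

/-- The determinant of two plane vectors. -/
def cross (a b : Plane) : ℝ := a 0 * b 1 - a 1 * b 0

/-- Rotation by a right angle. -/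
noncomputable def rot (a : Plane) : Plane := !₂[-a 1, a 0]

theorem dot_eq_inner (a b : Plane) : dot a b = inner ℝ a b := by
  simp [dot, PiLp.inner_apply, Fin.sum_univ_two, mul_comm]

theorem dot_self_eq_norm_sq (a : Plane) : dot a a = ‖a‖ ^ 2 := by
  rw [dot_eq_inner, real_inner_self_eq_norm_sq]

theorem dot_comm (a b : Plane) : dot a b = dot b a := by simp only [dot]; ring

theorem dot_add (a b c : Plane) : dot a (b + c) = dot a b + dot a c := by
  simp only [dot, PiLp.add_apply]; ring

theorem dot_sub (a b c : Plane) : dot a (b - c) = dot a b - dot a c := by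
  simp only [dot, PiLp.sub_apply]; ring

theorem dot_smul (r : ℝ) (a b : Plane) : dot a (r • b) = r * dot a b := by
  simp only [dot, PiLp.smul_apply, smul_eq_mul]; ring

theorem add_dot (a b c : Plane) : dot (a + b) c = dot a c + dot b c := by
  simp only [dot, PiLp.add_apply]; ring

theorem smul_dot (r : ℝ) (a b : Plane) : dot (r • a) b = r * dot a b := by
  simp only [dot, PiLp.smul_apply, smul_eq_mul]; ring

theorem neg_dot (a b : Plane) : dot (-a) b = -dot a b := by
  simp only [dot, PiLp.neg_apply]; ring

theorem dot_neg (a b : Plane) : dot a (-b) = -dot a b := by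
  simp only [dot, PiLp.neg_apply]; ring

theorem dot_zero (a : Plane) : dot a 0 = 0 := by simp [dot]

theorem rot_dot (a b : Plane) : dot (rot a) b = cross a b := by
  simp [dot, rot, cross]; ring

theorem dot_self_nonneg (a : Plane) : 0 ≤ dot a a := by
  rw [dot_self_eq_norm_sq]; positivity

theorem dot_self_pos {a : Plane} (h : a ≠ 0) : 0 < dot a a := by
  rw [dot_self_eq_norm_sq]; have := norm_pos_iff.2 h; positivity

theorem rot_ne_zero {a : Plane} (h : a ≠ 0) : rot a ≠ 0 := by
  intro h0
  have h1 := dot_self_pos h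
  have h2 : dot (rot a) (rot a) = dot a a := by simp [dot, rot]; ring
  rw [← h2, h0, dot_zero] at h1
  exact lt_irrefl _ h1

/-- Vectors orthogonal to the same nonzero vector are parallel. -/
theorem cross_eq_zero_of_dot_eq_zero {u a b : Plane} (hu : u ≠ 0) (ha : dot u a = 0)
    (hb : dot u b = 0) : cross a b = 0 := by
  have h := dot_self_pos hu
  simp only [dot] at *
  have h1 : (u 0 * u 0 + u 1 * u 1) * cross a b = 0 := by
    simp only [cross]
    linear_combination (u 0 * b 1 - u 1 * b 0) * ha + (u 1 * a 0 - u 0 * a 1) * hb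
  exact (mul_eq_zero.1 h1).resolve_left h.ne'

theorem exists_smul_of_cross_eq_zero {a b : Plane} (ha : a ≠ 0) (h : cross a b = 0) :
    b = (dot a b / dot a a) • a := by
  have h1 := (dot_self_pos ha).ne'
  ext i
  simp only [PiLp.smul_apply, smul_eq_mul]
  rw [div_mul_eq_mul_div, eq_div_iff h1]
  simp only [dot, cross] at *
  fin_cases i
  · simp only [Fin.zero_eta, Fin.isValue]
    linear_combination (-a 1) * h
  · simp only [Fin.mk_one, Fin.isValue]
    linear_combination (a 0) * h

theorem exists_smul_of_dot_eq_zero {u a b : Plane} (hu : u ≠ 0) (ha : a ≠ 0) (h1 : dot u a = 0)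
    (h2 : dot u b = 0) : b = (dot a b / dot a a) • a :=
  exists_smul_of_cross_eq_zero ha (cross_eq_zero_of_dot_eq_zero hu h1 h2)

/-! ### Visibility -/

section Config

variable {n : ℕ} {x : Fin n → Plane}

/-- Towards every agent one sees an agent. -/
theorem exists_visible_toward (hx : Function.Injective x) {i j : Fin n} (hij : j ≠ i) :
    ∃ k, k ≠ i ∧ Visible x i k ∧ ∃ θ : ℝ, 0 < θ ∧ θ ≤ 1 ∧ x k - x i = θ • (x j - x i) := by
  classical
  let S : Finset (Fin n) := Finset.univ.filter fun k =>
    k ≠ i ∧ ∃ θ : ℝ, 0 < θ ∧ θ ≤ 1 ∧ x k - x i = θ • (x j - x i)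
  have hS : S.Nonempty := ⟨j, by
    simp only [S, Finset.mem_filter, Finset.mem_univ, true_and]
    exact ⟨hij, 1, one_pos, le_rfl, by simp⟩⟩
  -- Among the agents on the segment towards `j`, the one nearest to `i` is unobstructed.
  obtain ⟨k, hk, hmin⟩ := S.exists_min_image (fun k => dot (x j - x i) (x k - x i)) hS
  simp only [S, Finset.mem_filter, Finset.mem_univ, true_and] at hk hmin
  obtain ⟨hki, θ, hθ, hθ1, hk⟩ := hk
  refine ⟨k, hki, ?_, θ, hθ, hθ1, hk⟩
  intro l hli hlk hl
  rw [segment_eq_image'] at hl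
  obtain ⟨s, ⟨hs0, hs1⟩, hs⟩ := hl
  have hl : x l - x i = s • (x k - x i) := by rw [← hs]; simp
  have hs0' : 0 < s := by
    rcases hs0.lt_or_eq with h | h
    · exact h
    · rw [← h, zero_smul, sub_eq_zero] at hl
      exact absurd (hx hl) hli
  have hs1' : s < 1 := by
    rcases hs1.lt_or_eq with h | h
    · exact h
    · rw [h, one_smul, sub_left_inj] at hl
      exact absurd (hx hl) hlk
  have hne : x j - x i ≠ 0 := fun h => hij (hx (sub_eq_zero.1 h))
  have h1 := hmin l ⟨hli, s * θ, by positivity, by nlinarith, by rw [hl, hk, smul_smul]⟩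
  simp only [hl, hk, dot_smul] at h1
  have h2 := mul_pos hθ (dot_self_pos hne)
  nlinarith

/-- A homogeneous linear inequality valid for the visible agents is valid for all of them. -/
theorem dot_nonneg_of_visible (hx : Function.Injective x) {i : Fin n} {u : Plane}
    (h : ∀ j, Visible x i j → 0 ≤ dot u (x j - x i)) (j : Fin n) : 0 ≤ dot u (x j - x i) := by
  by_cases hij : j = i
  · subst hij; simp [dot]
  obtain ⟨k, -, hv, θ, hθ, -, hk⟩ := exists_visible_toward hx hij
  have := h k hv
  rw [hk, dot_smul] at this
  exact nonneg_of_mul_nonneg_right this hθ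

/-- The agent `k` strictly obstructs `i` from seeing `j`. -/
theorem not_visible_of_between (hx : Function.Injective x) {i j k : Fin n} (hki : k ≠ i) {θ : ℝ}
    (hθ : θ < 1) (hθ0 : 0 ≤ θ) (h : x k - x i = θ • (x j - x i)) : ¬ Visible x i j := by
  intro hv
  by_cases hkj : k = j
  · subst hkj
    have h1 : (1 - θ) • (x k - x i) = 0 := by rw [sub_smul, one_smul, ← h, sub_self]
    rcases smul_eq_zero.1 h1 with h1 | h1
    · linarith
    · exact hki (hx (sub_eq_zero.1 h1))
  · refine hv k hki hkj ?_
    rw [segment_eq_image']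
    exact ⟨θ, ⟨hθ0, hθ.le⟩, by simp [← h]⟩

/-! ### Corners -/

/-- The agent `i` is strictly extremal in some direction. -/
def Corner (x : Fin n → Plane) (i : Fin n) : Prop :=
  ∃ v : Plane, ∀ j, j ≠ i → 0 < dot v (x j - x i)

/-- Strictness of the separation is what excludes collisions with a corner. -/
theorem Corner.eq_of_pos_eq {i j : Fin n} (h : Corner x i) (hij : x i = x j) : i = j := by
  obtain ⟨v, hv⟩ := h
  by_contra hne
  have := hv j (Ne.symm hne)
  rw [hij, sub_self, dot_zero] at this
  exact lt_irrefl _ this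

theorem Corner.atCorner {i : Fin n} (h : Corner x i) : AtCorner x i := by
  obtain ⟨v, hv⟩ := h
  -- The point `x i` together with an open half-plane at it is convex.
  have key : ∀ z ∈ convexHull ℝ (Set.range x), z = x i ∨ 0 < dot v (z - x i) := by
    intro z hz
    refine convexHull_min (t := {z | z = x i ∨ 0 < dot v (z - x i)}) ?_ ?_ hz
    · rintro _ ⟨j, rfl⟩
      by_cases hj : j = i
      · exact Or.inl (by rw [hj])
      · exact Or.inr (hv j hj)
    · rw [convex_iff_forall_pos]
      intro a ha b hb s t hs ht hst
      have e : s • a + t • b - x i = s • (a - x i) + t • (b - x i) := by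
        rw [smul_sub, smul_sub, sub_add_sub_comm, ← add_smul, hst, one_smul]
      simp only [Set.mem_ofPred_eq] at *
      rcases ha with ha | ha <;> rcases hb with hb | hb
      · left; rw [ha, hb, ← add_smul, hst, one_smul]
      · right; rw [e, ha, dot_add, dot_smul, dot_smul, sub_self, dot_zero]; nlinarith
      · right; rw [e, hb, dot_add, dot_smul, dot_smul, sub_self, dot_zero]; nlinarith
      · right; rw [e, dot_add, dot_smul, dot_smul]; nlinarith
  refine ⟨subset_convexHull ℝ _ ⟨i, rfl⟩, ?_⟩
  rintro a ha b hb ⟨s, t, hs, ht, hst, hab⟩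
  have e : s * dot v (a - x i) + t * dot v (b - x i) = 0 := by
    rw [← dot_smul, ← dot_smul, ← dot_add, smul_sub, smul_sub, sub_add_sub_comm, ← add_smul, hst,
      one_smul, hab, sub_self, dot_zero]
  rcases key a ha with h1 | h1
  · exact h1
  · have h2 : 0 ≤ dot v (b - x i) := by
      rcases key b hb with h | h
      · rw [h, sub_self, dot_zero]
      · exact h.le
    nlinarith [mul_pos hs h1, mul_nonneg ht.le h2]

/-- A corner never obstructs. -/
theorem Corner.notMem_segment {i j k : Fin n} (h : Corner x k) (hi : k ≠ i) (hj : k ≠ j) :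
    x k ∉ segment ℝ (x i) (x j) := by
  obtain ⟨v, hv⟩ := h
  rintro ⟨s, t, hs, ht, hst, e⟩
  have h1 := hv i hi.symm
  have h2 := hv j hj.symm
  have e : s * dot v (x i - x k) + t * dot v (x j - x k) = 0 := by
    rw [← dot_smul, ← dot_smul, ← dot_add, smul_sub, smul_sub, sub_add_sub_comm, ← add_smul, hst,
      one_smul, e, sub_self, dot_zero]
  rcases hs.lt_or_eq with h | h
  · nlinarith [mul_pos h h1, mul_nonneg ht h2.le]
  · rw [← h] at hst e
    nlinarith

theorem obstructionFree_of_corners (h : ∀ i, Corner x i) : ObstructionFree x :=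
  fun _ _ k hi hj => (h k).notMem_segment hi hj

/-- If all visible agents are corners, then nothing is hidden. -/
theorem visible_of_forall_visible_corner (hx : Function.Injective x) {i : Fin n}
    (h : ∀ j, Visible x i j → Corner x j) (j : Fin n) : Visible x i j := by
  by_cases hij : j = i
  · subst hij
    intro k hk _
    rw [segment_same]
    exact fun h => hk (hx h)
  obtain ⟨k, hki, hv, θ, hθ, hθ1, hk⟩ := exists_visible_toward hx hij
  by_cases hkj : k = j
  · rwa [← hkj]
  · refine absurd ?_ ((h k hv).notMem_segment hki hkj)
    rw [segment_eq_image']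
    exact ⟨θ, ⟨hθ.le, hθ1⟩, by simp [← hk]⟩

/-- Lexicographic minima for two linear forms are corners. -/
theorem corner_of_lex {i : Fin n} (u w : Plane)
    (h : ∀ j, j ≠ i → 0 < dot u (x j - x i) ∨ (dot u (x j - x i) = 0 ∧ 0 < dot w (x j - x i))) :
    Corner x i := by
  -- The direction `u + ε • w` separates for small `ε`; finitely many agents restrict `ε`.
  have key : ∀ j : Fin n, ∀ᶠ ε : ℝ in nhdsWithin 0 (Set.Ioi 0),
      j ≠ i → 0 < dot (u + ε • w) (x j - x i) := by
    intro j
    by_cases hj : j = i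
    · exact Filter.Eventually.of_forall fun _ h => absurd hj h
    rcases h j hj with h1 | ⟨h1, h2⟩
    · have hc : Filter.Tendsto (fun ε : ℝ => dot (u + ε • w) (x j - x i)) (nhds 0)
          (nhds (dot u (x j - x i))) := by
        have : (fun ε : ℝ => dot (u + ε • w) (x j - x i)) =
            fun ε => dot u (x j - x i) + ε * dot w (x j - x i) := by
          funext ε; rw [add_dot, smul_dot]
        rw [this]
        have h3 : Continuous fun ε : ℝ => dot u (x j - x i) + ε * dot w (x j - x i) := by fun_prop
        simpa using h3.tendsto 0
      filter_upwards [(hc.mono_left nhdsWithin_le_nhds).eventually (lt_mem_nhds h1)] with ε hε _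
      exact hε
    · filter_upwards [self_mem_nhdsWithin] with ε hε _
      rw [add_dot, smul_dot, h1, zero_add]
      exact mul_pos hε h2
  obtain ⟨ε, hε⟩ := (Filter.eventually_all.2 key).exists
  exact ⟨u + ε • w, hε⟩

/-- Every nonzero linear form is minimal at some corner. -/
theorem exists_corner_minimizing (hx : Function.Injective x) (u : Plane) (hu : u ≠ 0) (i : Fin n) :
    ∃ a, Corner x a ∧ ∀ j, dot u (x a) ≤ dot u (x j) := by
  classical
  obtain ⟨m, -, hm⟩ := Finset.univ.exists_min_image (fun j => dot u (x j)) ⟨i, Finset.mem_univ _⟩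
  let S := Finset.univ.filter fun j => dot u (x j) = dot u (x m)
  -- Ties for `u` are broken by the orthogonal form `rot u`.
  obtain ⟨a, ha, hmin⟩ := S.exists_min_image (fun j => dot (rot u) (x j)) ⟨m, by simp [S]⟩
  simp only [S, Finset.mem_filter, Finset.mem_univ, true_and, true_implies] at ha hmin hm
  refine ⟨a, corner_of_lex u (rot u) fun j hj => ?_, fun j => ha ▸ hm j⟩
  rw [dot_sub, dot_sub]
  rcases (hm j).lt_or_eq with h | h
  · left; linarith
  · right
    refine ⟨by linarith, ?_⟩
    rcases (hmin j h.symm).lt_or_eq with h1 | h1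
    · linarith
    · exfalso
      have h2 : dot u (x j - x a) = 0 := by rw [dot_sub]; linarith
      have h3 : dot (rot u) (x j - x a) = 0 := by rw [dot_sub]; linarith
      rw [rot_dot] at h3
      have h4 := exists_smul_of_cross_eq_zero hu h3
      rw [h2, zero_div, zero_smul] at h4
      exact hj (hx (sub_eq_zero.1 h4))

/-- A corner has an extremal agent in each of the two turning directions. -/
theorem Corner.exists_left (hx : Function.Injective x) {a : Fin n} (h : Corner x a) {i : Fin n}
    (hi : i ≠ a) : ∃ b, b ≠ a ∧ Visible x a b ∧ ∀ j, 0 ≤ cross (x b - x a) (x j - x a) := by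
  classical
  obtain ⟨v, hv⟩ := h
  -- All other agents are in an open half-plane around `v`, where this quotient is the tangent of
  -- the angle from `v`.
  obtain ⟨m, hm, hmin⟩ := (Finset.univ.filter fun j => j ≠ a).exists_min_image
    (fun j => cross v (x j - x a) / dot v (x j - x a)) ⟨i, by simp [hi]⟩
  simp only [Finset.mem_filter, Finset.mem_univ, true_and] at hm hmin
  have key : ∀ j, 0 ≤ cross (x m - x a) (x j - x a) := by
    intro j
    by_cases hj : j = a
    · simp [hj, cross]
    have h1 := hmin j hj
    have h2 := hv j hj
    have h3 := hv m hm
    rw [div_le_div_iff₀ h3 h2] at h1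
    have hv0 : v ≠ 0 := by
      rintro rfl
      simp [dot] at h2
    have h4 : dot v v * cross (x m - x a) (x j - x a) =
        cross v (x j - x a) * dot v (x m - x a) - cross v (x m - x a) * dot v (x j - x a) := by
      simp only [dot, cross]; ring
    exact nonneg_of_mul_nonneg_right (by rw [h4]; linarith) (dot_self_pos hv0)
  obtain ⟨b, hb, hvis, θ, hθ, -, e⟩ := exists_visible_toward hx hm
  refine ⟨b, hb, hvis, fun j => ?_⟩
  rw [e, ← rot_dot]
  have := key j
  rw [← rot_dot] at this
  have e2 : rot (θ • (x m - x a)) = θ • rot (x m - x a) := by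
    ext i; fin_cases i <;> simp [rot]
    ring
  rw [e2, smul_dot]
  positivity

theorem Corner.exists_right (hx : Function.Injective x) {a : Fin n} (h : Corner x a) {i : Fin n}
    (hi : i ≠ a) : ∃ b, b ≠ a ∧ Visible x a b ∧ ∀ j, cross (x b - x a) (x j - x a) ≤ 0 := by
  classical
  obtain ⟨v, hv⟩ := h
  obtain ⟨m, hm, hmin⟩ := (Finset.univ.filter fun j => j ≠ a).exists_max_image
    (fun j => cross v (x j - x a) / dot v (x j - x a)) ⟨i, by simp [hi]⟩
  simp only [Finset.mem_filter, Finset.mem_univ, true_and] at hm hmin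
  have key : ∀ j, cross (x m - x a) (x j - x a) ≤ 0 := by
    intro j
    by_cases hj : j = a
    · simp [hj, cross]
    have h1 := hmin j hj
    have h2 := hv j hj
    have h3 := hv m hm
    rw [div_le_div_iff₀ h2 h3] at h1
    have hv0 : v ≠ 0 := by
      rintro rfl
      simp [dot] at h2
    have h4 : dot v v * cross (x m - x a) (x j - x a) =
        cross v (x j - x a) * dot v (x m - x a) - cross v (x m - x a) * dot v (x j - x a) := by
      simp only [dot, cross]; ring
    exact nonpos_of_mul_nonpos_right (by rw [h4]; linarith) (dot_self_pos hv0)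
  obtain ⟨b, hb, hvis, θ, hθ, -, e⟩ := exists_visible_toward hx hm
  refine ⟨b, hb, hvis, fun j => ?_⟩
  have e2 : cross (θ • (x m - x a)) (x j - x a) = θ * cross (x m - x a) (x j - x a) := by
    simp only [cross, PiLp.smul_apply, smul_eq_mul]; ring
  rw [e, e2]
  exact mul_nonpos_of_nonneg_of_nonpos hθ.le (key j)

end Config

/-! ### The algorithm

The colors in use are black `0`, red `1` and green `2`. -/

/-- Green or red: the color of an agent that knows itself to be a corner. -/
def Lit (c : Fin 5) : Prop := c = 1 ∨ c = 2

/-- The observer is a corner. -/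
def ViewCorner (W : Set (Plane × Fin 5)) : Prop :=
  ∃ v, ∀ q ∈ W, q.1 ≠ 0 → 0 < dot v q.1

/-- All visible agents are on a line through the observer, and `y` is orthogonal to it. -/
def ViewLine (W : Set (Plane × Fin 5)) (y : Plane) : Prop :=
  y ≠ 0 ∧ ∀ q ∈ W, dot y q.1 = 0

/-- The observer is in the interior of the convex hull. -/
def ViewInterior (W : Set (Plane × Fin 5)) : Prop :=
  ∀ u : Plane, u ≠ 0 → ∃ q ∈ W, dot u q.1 < 0

/-- The direction `d` is along the boundary of the convex hull, seen from a boundary agent. -/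
def ViewEdge (W : Set (Plane × Fin 5)) (d : Plane) : Prop :=
  d ≠ 0 ∧ ∃ u : Plane, u ≠ 0 ∧ dot u d = 0 ∧ ∀ q ∈ W, 0 ≤ dot u q.1

/-- One neighbor of the observer on the boundary of the hull is unlit, and `y` is a short move towards
another one. -/
def ViewSlide (W : Set (Plane × Fin 5)) (y : Plane) : Prop :=
  ∃ p ∈ W, ∃ q ∈ W, ¬ Lit p.2 ∧ ViewEdge W p.1 ∧ ViewEdge W q.1 ∧ p.1 ≠ q.1 ∧
    ∃ r : ℝ, 0 < r ∧ y = r • q.1 ∧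
      ∀ w ∈ W, 0 < dot q.1 w.1 → 2 * r * dot q.1 q.1 < dot q.1 w.1

/-- The point `y` is the foot of the perpendicular from the observer to an edge with lit endpoints,
and no unlit agent is closer to this edge than the observer. -/
def ViewDrop (W : Set (Plane × Fin 5)) (y : Plane) : Prop :=
  y ≠ 0 ∧ ∃ a ∈ W, ∃ b ∈ W, Lit a.2 ∧ Lit b.2 ∧ a.1 ≠ b.1 ∧
    (∃ τ : ℝ, 0 < τ ∧ τ < 1 ∧ y = (1 - τ) • a.1 + τ • b.1) ∧ dot y (b.1 - a.1) = 0 ∧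
    (∀ q ∈ W, dot y q.1 ≤ dot y y) ∧ ∀ q ∈ W, ¬ Lit q.2 → dot y q.1 ≤ 0

/-- A nearest foot. -/
def ViewBestDrop (W : Set (Plane × Fin 5)) (y : Plane) : Prop :=
  ViewDrop W y ∧ ∀ z, ViewDrop W z → dot y y ≤ dot z z

/-- The possible destinations and new colors of an agent, given its view and color. -/
inductive Rule (W : Set (Plane × Fin 5)) : Fin 5 → Plane → Fin 5 → Prop
  | red : Rule W 1 0 1
  | finish : (∀ q ∈ W, Lit q.2) → Rule W 2 0 1
  | slide (y) : ¬ (∀ q ∈ W, Lit q.2) → ViewSlide W y → Rule W 2 y 2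
  | wait : ¬ (∀ q ∈ W, Lit q.2) → ¬ (∃ y, ViewSlide W y) → Rule W 2 0 2
  | light (c) : ¬ Lit c → ViewCorner W → Rule W c 0 2
  | leaveLine (c y) : ¬ Lit c → ¬ ViewCorner W → ViewLine W y → Rule W c y c
  | drop (c y) : ¬ Lit c → ¬ ViewCorner W → ¬ (∃ z, ViewLine W z) → ViewInterior W →
      ViewBestDrop W y → Rule W c y c
  | idle (c) : ¬ Lit c → ¬ ViewCorner W → ¬ (∃ z, ViewLine W z) →
      ¬ (ViewInterior W ∧ ∃ y, ViewBestDrop W y) → Rule W c 0 c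

/-- The rules cover all cases but leave the destination open. The algorithm is an arbitrary choice,
and later arguments use only that it obeys `Rule`. -/
theorem Rule.exists (W : Set (Plane × Fin 5)) (c : Fin 5) : ∃ o : Plane × Fin 5, Rule W c o.1 o.2 := by
  by_cases h1 : c = 1
  · subst h1; exact ⟨(0, 1), .red⟩
  by_cases h2 : c = 2
  · subst h2
    by_cases h : ∀ q ∈ W, Lit q.2
    · exact ⟨(0, 1), .finish h⟩
    by_cases hs : ∃ y, ViewSlide W y
    · obtain ⟨y, hy⟩ := hs
      exact ⟨(y, 2), .slide y h hy⟩
    · exact ⟨(0, 2), .wait h hs⟩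
  have hc : ¬ Lit c := fun h => h.elim h1 h2
  by_cases h : ViewCorner W
  · exact ⟨(0, 2), .light c hc h⟩
  by_cases hl : ∃ z, ViewLine W z
  · obtain ⟨y, hy⟩ := hl
    exact ⟨(y, c), .leaveLine c y hc h hy⟩
  by_cases hd : ViewInterior W ∧ ∃ y, ViewBestDrop W y
  · obtain ⟨hi, y, hy⟩ := hd
    exact ⟨(y, c), .drop c y hc h hl hi hy⟩
  · exact ⟨(0, c), .idle c hc h hl hd⟩

/-- The algorithm. -/
noncomputable def convexAlgorithm : Algorithm (Fin 5) := fun c W => (Rule.exists W c).choose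

theorem convexAlgorithm_rule (c : Fin 5) (W : Set (Plane × Fin 5)) :
    Rule W c (convexAlgorithm c W).1 (convexAlgorithm c W).2 := (Rule.exists W c).choose_spec

theorem convexAlgorithm_red (W : Set (Plane × Fin 5)) : convexAlgorithm 1 W = (0, 1) := by
  have h := convexAlgorithm_rule 1 W
  generalize hp : convexAlgorithm 1 W = o at h
  obtain ⟨y, c⟩ := o
  have h1 : Lit 1 := Or.inl rfl
  simp only at h
  cases h <;> first | rfl | (exfalso; exact absurd h1 (by assumption))

/-! ### Independence of the frame -/

/-- A linear similarity of the plane. -/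
structure Similarity (L : Plane →ₗ[ℝ] Plane) (k : ℝ) : Prop where
  pos : 0 < k
  dot_map : ∀ a b, dot (L a) (L b) = k * dot a b
  surj : Function.Surjective L

/-- The image of a view under a linear map. -/
def mapView (L : Plane →ₗ[ℝ] Plane) (W : Set (Plane × Fin 5)) : Set (Plane × Fin 5) :=
  (fun q => (L q.1, q.2)) '' W

section Similarity

variable {L : Plane →ₗ[ℝ] Plane} {k : ℝ} {W : Set (Plane × Fin 5)}

theorem forall_mapView {p : Plane × Fin 5 → Prop} :
    (∀ q ∈ mapView L W, p q) ↔ ∀ q ∈ W, p (L q.1, q.2) := Set.forall_mem_image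

theorem exists_mapView {p : Plane × Fin 5 → Prop} :
    (∃ q ∈ mapView L W, p q) ↔ ∃ q ∈ W, p (L q.1, q.2) := Set.exists_mem_image

namespace Similarity

theorem dot_pos (h : Similarity L k) (a b : Plane) : 0 < dot (L a) (L b) ↔ 0 < dot a b := by
  rw [h.dot_map]; exact mul_pos_iff_of_pos_left h.pos

theorem dot_nonneg (h : Similarity L k) (a b : Plane) : 0 ≤ dot (L a) (L b) ↔ 0 ≤ dot a b := by
  rw [h.dot_map]; exact mul_nonneg_iff_of_pos_left h.pos

theorem dot_le (h : Similarity L k) (a b c d : Plane) :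
    dot (L a) (L b) ≤ dot (L c) (L d) ↔ dot a b ≤ dot c d := by
  rw [h.dot_map, h.dot_map]; exact mul_le_mul_iff_right₀ h.pos

theorem dot_neg (h : Similarity L k) (a b : Plane) : dot (L a) (L b) < 0 ↔ dot a b < 0 := by
  rw [← not_le, ← not_le, h.dot_nonneg]

theorem dot_nonpos (h : Similarity L k) (a b : Plane) : dot (L a) (L b) ≤ 0 ↔ dot a b ≤ 0 := by
  rw [← not_lt, ← not_lt, h.dot_pos]

theorem dot_eq_zero (h : Similarity L k) (a b : Plane) : dot (L a) (L b) = 0 ↔ dot a b = 0 := by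
  rw [h.dot_map]; simp [h.pos.ne']

theorem inj (h : Similarity L k) : Function.Injective L := by
  rw [← LinearMap.ker_eq_bot, LinearMap.ker_eq_bot']
  intro a ha
  by_contra h0
  have h1 := (h.dot_pos a a).2 (dot_self_pos h0)
  rw [ha, dot_zero] at h1
  exact lt_irrefl _ h1

theorem map_ne_zero (h : Similarity L k) (a : Plane) : L a ≠ 0 ↔ a ≠ 0 :=
  (map_ne_zero_iff L h.inj)

/-- Directions are quantified over the whole plane, so surjectivity allows them to be pulled back
along `L`. -/
theorem viewCorner (h : Similarity L k) : ViewCorner (mapView L W) ↔ ViewCorner W := by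
  rw [ViewCorner, h.surj.exists]
  simp only [ViewCorner, forall_mapView, h.dot_pos, h.map_ne_zero]

theorem viewLine (h : Similarity L k) (y : Plane) : ViewLine (mapView L W) (L y) ↔ ViewLine W y := by
  simp only [ViewLine, forall_mapView, h.dot_eq_zero, h.map_ne_zero]

theorem viewInterior (h : Similarity L k) : ViewInterior (mapView L W) ↔ ViewInterior W := by
  rw [ViewInterior, h.surj.forall]
  simp only [ViewInterior, exists_mapView, h.dot_neg, h.map_ne_zero]

theorem viewEdge (h : Similarity L k) (d : Plane) :
    ViewEdge (mapView L W) (L d) ↔ ViewEdge W d := by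
  rw [ViewEdge, h.surj.exists]
  simp only [ViewEdge, forall_mapView, h.dot_eq_zero, h.dot_nonneg, h.map_ne_zero]

theorem viewSlide (h : Similarity L k) (y : Plane) :
    ViewSlide (mapView L W) (L y) ↔ ViewSlide W y := by
  have h1 : ∀ (r : ℝ) (a b : Plane),
      2 * r * dot (L a) (L a) < dot (L a) (L b) ↔ 2 * r * dot a a < dot a b := by
    intro r a b
    rw [h.dot_map, h.dot_map, mul_left_comm, mul_lt_mul_iff_right₀ h.pos]
  simp only [ViewSlide, exists_mapView, forall_mapView, h.viewEdge, h.inj.ne_iff, ← map_smul,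
    h.inj.eq_iff, h.dot_pos, h1]

theorem viewDrop (h : Similarity L k) (y : Plane) :
    ViewDrop (mapView L W) (L y) ↔ ViewDrop W y := by
  simp only [ViewDrop, exists_mapView, forall_mapView, h.map_ne_zero, h.inj.ne_iff, ← map_smul,
    ← map_add, ← map_sub, h.inj.eq_iff, h.dot_eq_zero, h.dot_le, h.dot_nonpos]

theorem viewBestDrop (h : Similarity L k) (y : Plane) :
    ViewBestDrop (mapView L W) (L y) ↔ ViewBestDrop W y := by
  rw [ViewBestDrop, h.surj.forall]
  simp only [ViewBestDrop, h.viewDrop, h.dot_le]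

/-- Each condition in `Rule` is a linear relation or a comparison of scalar products that is
insensitive to a common positive factor. The choice made in local coordinates may depend on the
frame, but it always pulls back to a permitted choice. -/
theorem rule (h : Similarity L k) {c c' : Fin 5} {z : Plane} (hr : Rule (mapView L W) c z c') :
    ∃ y, z = L y ∧ Rule W c y c' := by
  have h0 : (0 : Plane) = L 0 := (map_zero L).symm
  have hl : (∀ q ∈ mapView L W, Lit q.2) ↔ ∀ q ∈ W, Lit q.2 := forall_mapView
  cases hr with
  | red => exact ⟨0, h0, .red⟩
  | finish h1 => exact ⟨0, h0, .finish (hl.1 h1)⟩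
  | slide z h1 h2 =>
    obtain ⟨y, rfl⟩ := h.surj z
    exact ⟨y, rfl, .slide y (mt hl.2 h1) ((h.viewSlide y).1 h2)⟩
  | wait h1 h2 =>
    rw [h.surj.exists] at h2
    simp only [h.viewSlide] at h2
    exact ⟨0, h0, .wait (mt hl.2 h1) h2⟩
  | light _ h1 h2 => exact ⟨0, h0, .light c h1 (h.viewCorner.1 h2)⟩
  | leaveLine _ z h1 h2 h3 =>
    obtain ⟨y, rfl⟩ := h.surj z
    exact ⟨y, rfl, .leaveLine c y h1 (mt h.viewCorner.2 h2) ((h.viewLine y).1 h3)⟩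
  | drop _ z h1 h2 h3 h4 h5 =>
    obtain ⟨y, rfl⟩ := h.surj z
    rw [h.surj.exists] at h3
    simp only [h.viewLine] at h3
    exact ⟨y, rfl, .drop c y h1 (mt h.viewCorner.2 h2) h3 (h.viewInterior.1 h4)
      ((h.viewBestDrop y).1 h5)⟩
  | idle _ h1 h2 h3 h4 =>
    rw [h.surj.exists] at h3 h4
    simp only [h.viewLine, h.viewBestDrop, h.viewInterior] at h3 h4
    exact ⟨0, h0, .idle c h1 (mt h.viewCorner.2 h2) h3 h4⟩

end Similarity

end Similarity

/-- The linear part of a frame. -/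
noncomputable def Frame.linear (F : Frame) : Plane →ₗ[ℝ] Plane :=
  F.scale • F.isom.toLinearEquiv.toLinearMap

theorem Frame.linear_apply (F : Frame) (a : Plane) : F.linear a = F.scale • F.isom a := rfl

theorem Frame.similarity (F : Frame) : Similarity F.linear (F.scale ^ 2) where
  pos := pow_pos F.scale_pos 2
  dot_map a b := by
    rw [F.linear_apply, F.linear_apply, smul_dot, dot_smul, dot_eq_inner, dot_eq_inner,
      F.isom.inner_map_map]
    ring
  surj z := ⟨F.isom.symm (F.scale⁻¹ • z), by
    rw [F.linear_apply, F.isom.apply_symm_apply, smul_smul, mul_inv_cancel₀ F.scale_pos.ne',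
      one_smul]⟩

theorem Frame.toGlobal_linear (F : Frame) (o a : Plane) : F.toGlobal o (F.linear a) = o + a := by
  have := F.toGlobal_toLocal o (o + a)
  rwa [Frame.toLocal, add_sub_cancel_left] at this

/-- The view of an agent in global directions and units. -/
def relView {n : ℕ} (x : Fin n → Plane) (c : Fin n → Fin 5) (i : Fin n) : Set (Plane × Fin 5) :=
  {p | ∃ j : Fin n, Visible x i j ∧ p = (x j - x i, c j)}

theorem forall_relView {n : ℕ} {x : Fin n → Plane} {c : Fin n → Fin 5} {i : Fin n}
    {p : Plane × Fin 5 → Prop} :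
    (∀ q ∈ relView x c i, p q) ↔ ∀ j, Visible x i j → p (x j - x i, c j) := by
  constructor
  · exact fun h j hj => h _ ⟨j, hj, rfl⟩
  · rintro h _ ⟨j, hj, rfl⟩
    exact h j hj

theorem exists_relView {n : ℕ} {x : Fin n → Plane} {c : Fin n → Fin 5} {i : Fin n}
    {p : Plane × Fin 5 → Prop} :
    (∃ q ∈ relView x c i, p q) ↔ ∃ j, Visible x i j ∧ p (x j - x i, c j) := by
  constructor
  · rintro ⟨_, ⟨j, hj, rfl⟩, h⟩
    exact ⟨j, hj, h⟩
  · rintro ⟨j, hj, h⟩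
    exact ⟨_, ⟨j, hj, rfl⟩, h⟩

theorem localView_eq_mapView {n : ℕ} (x : Fin n → Plane) (c : Fin n → Fin 5) (F : Frame)
    (i : Fin n) : localView x c F i = mapView F.linear (relView x c i) := by
  ext p
  constructor
  · rintro ⟨j, hj, rfl⟩
    exact ⟨_, ⟨j, hj, rfl⟩, rfl⟩
  · rintro ⟨_, ⟨j, hj, rfl⟩, rfl⟩
    exact ⟨j, hj, rfl⟩

/-! ### One round -/

/-- The displacement `v` results from a possibly interrupted move towards `y`. -/
def PartialMove (δ : ℝ) (y v : Plane) : Prop :=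
  ∃ s : ℝ, 0 ≤ s ∧ s ≤ 1 ∧ v = s • y ∧ (s = 1 ∨ δ ≤ ‖v‖)

theorem PartialMove.pos {δ : ℝ} (hδ : 0 < δ) {y v : Plane} (h : PartialMove δ y v) :
    ∃ s : ℝ, 0 < s ∧ s ≤ 1 ∧ v = s • y ∧ (s = 1 ∨ δ ≤ ‖v‖) := by
  obtain ⟨s, h0, h1, hv, h⟩ := h
  refine ⟨s, ?_, h1, hv, h⟩
  rcases h with rfl | h
  · exact one_pos
  · rcases h0.lt_or_eq with h2 | h2
    · exact h2
    · rw [hv, ← h2, zero_smul, norm_zero] at h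
      linarith

/-- A round of the algorithm in which exactly the agents in `act` are active. -/
def Step {n : ℕ} (δ : ℝ) (act : Set (Fin n)) (x : Fin n → Plane) (c : Fin n → Fin 5)
    (x' : Fin n → Plane) (c' : Fin n → Fin 5) : Prop :=
  ∀ i, (i ∉ act → x' i = x i ∧ c' i = c i) ∧
    (i ∈ act → ∃ y, PartialMove δ y (x' i - x i) ∧ Rule (relView x c i) (c i) y (c' i))

/-- Eliminates the frames: from here on, rounds are described in global directions and units. -/
theorem SSYNCExecution.step {black : Fin 5} {n : ℕ} {δ : ℝ}
    (E : SSYNCExecution convexAlgorithm black n δ) (t : ℕ) :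
    Step δ (E.active t) (E.pos t) (E.col t) (E.pos (t + 1)) (E.col (t + 1)) := by
  intro i
  refine ⟨fun h => ⟨E.idle_pos t i h, E.idle_col t i h⟩, fun h => ?_⟩
  have h1 := E.step_col t i h
  have h2 := E.step_pos t i h
  have h3 := convexAlgorithm_rule (E.col t i) (localView (E.pos t) (E.col t) (E.frame t i) i)
  rw [← h1] at h3
  generalize (convexAlgorithm (E.col t i)
    (localView (E.pos t) (E.col t) (E.frame t i) i)).1 = z at h2 h3
  rw [localView_eq_mapView] at h3
  obtain ⟨y, rfl, hy⟩ := (E.frame t i).similarity.rule h3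
  refine ⟨y, ?_, hy⟩
  rw [Frame.toGlobal_linear] at h2
  obtain ⟨h4, h5⟩ := h2
  rw [segment_eq_image'] at h4
  obtain ⟨s, ⟨hs0, hs1⟩, e⟩ := h4
  simp only [add_sub_cancel_left] at e
  rcases h5 with h5 | h5
  · exact ⟨1, zero_le_one, le_rfl, by rw [h5]; simp, Or.inl rfl⟩
  · refine ⟨s, hs0, hs1, by rw [← e]; simp, Or.inr ?_⟩
    rwa [dist_comm, dist_eq_norm] at h5

/-! ### The geometry of one round -/

theorem eq_zero_of_dot_rot {u z : Plane} (hu : u ≠ 0) (h1 : dot u z = 0)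
    (h2 : dot (rot u) z = 0) : z = 0 := by
  rw [rot_dot] at h2
  rw [exists_smul_of_cross_eq_zero hu h2, h1, zero_div, zero_smul]

section Moves

variable {n : ℕ} {x x' : Fin n → Plane} {c c' : Fin n → Fin 5} {δ : ℝ} {act : Set (Fin n)}

/-- All agents are collinear. -/
def Flat (x : Fin n → Plane) : Prop := ∃ y : Plane, y ≠ 0 ∧ ∀ i j, dot y (x j - x i) = 0

/-- The agents `i` and `j` are on a common supporting line of the hull. -/
def OnEdge (x : Fin n → Plane) (i j : Fin n) : Prop :=
  ∃ u : Plane, u ≠ 0 ∧ dot u (x j - x i) = 0 ∧ ∀ k, 0 ≤ dot u (x k - x i)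

/-- The agent `i` is in the interior of the hull. -/
def Interior (x : Fin n → Plane) (i : Fin n) : Prop :=
  ∀ u : Plane, u ≠ 0 → ∃ k, dot u (x k - x i) < 0

/-- The corner `i`, whose boundary neighbor `e` is unlit, moves by `v` towards the boundary
neighbor `f`. -/
structure SlideMove (x : Fin n → Plane) (c : Fin n → Fin 5) (i e f : Fin n) (r : ℝ) (v : Plane) :
    Prop where
  corner : Corner x i
  ne_left : e ≠ i
  ne_right : f ≠ i
  ne : e ≠ f
  visible_left : Visible x i e
  visible_right : Visible x i f
  unlit : ¬ Lit (c e)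
  edge_left : OnEdge x i e
  edge_right : OnEdge x i f
  pos : 0 < r
  eq : v = r • (x f - x i)
  short : ∀ j, 0 < dot (x f - x i) (x j - x i) →
    2 * r * dot (x f - x i) (x f - x i) < dot (x f - x i) (x j - x i)

/-- The vector `y` leads from `i` to the open edge between the corners `a` and `b`, perpendicularly,
and no agent except corners is closer to this edge than `i`. -/
structure DropVec (x : Fin n → Plane) (i a b : Fin n) (τ : ℝ) (y : Plane) : Prop where
  ne_zero : y ≠ 0
  corner_left : Corner x a
  corner_right : Corner x b
  ne : a ≠ b
  pos : 0 < τ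
  lt_one : τ < 1
  eq : y = (1 - τ) • (x a - x i) + τ • (x b - x i)
  perp : dot y (x b - x a) = 0
  supporting : ∀ j, dot y (x j - x i) ≤ dot y y
  nearest : ∀ j, ¬ Corner x j → dot y (x j - x i) ≤ 0

/-- The possible displacements of an agent. -/
inductive Displacement (δ : ℝ) (x : Fin n → Plane) (c : Fin n → Fin 5) (i : Fin n) (v : Plane) : Prop
  | stay : v = 0 → Displacement δ x c i v
  | slide (e f r) : SlideMove x c i e f r v → Displacement δ x c i v
  | leaveLine : ¬ Corner x i → v ≠ 0 → (∀ j, dot v (x j - x i) = 0) → Displacement δ x c i v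
  | drop (a b : Fin n) (τ : ℝ) (y : Plane) (s : ℝ) : ¬ Corner x i → Interior x i → DropVec x i a b τ y → 0 < s → s ≤ 1 →
      v = s • y → (s = 1 ∨ δ ≤ ‖v‖) → ViewBestDrop (relView x c i) y → Displacement δ x c i v

/-- The invariant of the algorithm. -/
structure ConfigInv (x : Fin n → Plane) (c : Fin n → Fin 5) : Prop where
  inj : Function.Injective x
  corner : ∀ i, Lit (c i) → Corner x i

/-! ### What a local view reveals about the whole configuration -/

theorem viewCorner_iff (hx : Function.Injective x) (i : Fin n) :
    ViewCorner (relView x c i) ↔ Corner x i := by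
  simp only [ViewCorner, forall_relView]
  constructor
  · rintro ⟨v, hv⟩
    refine ⟨v, fun j hj => ?_⟩
    obtain ⟨k, hk, hvis, θ, hθ, -, e⟩ := exists_visible_toward hx hj
    have := hv k hvis (fun h => hk (hx (sub_eq_zero.1 h)))
    rw [e, dot_smul] at this
    exact (mul_pos_iff_of_pos_left hθ).1 this
  · rintro ⟨v, hv⟩
    exact ⟨v, fun j _ hj => hv j (fun h => hj (by rw [h, sub_self]))⟩

theorem viewInterior_iff (hx : Function.Injective x) (i : Fin n) :
    ViewInterior (relView x c i) ↔ Interior x i := by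
  simp only [ViewInterior, Interior, exists_relView]
  refine forall_congr' fun u => imp_congr_right fun _ => ?_
  constructor
  · rintro ⟨j, -, h⟩
    exact ⟨j, h⟩
  · rintro ⟨j, h⟩
    by_contra! h1
    exact absurd (dot_nonneg_of_visible hx h1 j) (not_le.2 h)

theorem viewEdge_iff (hx : Function.Injective x) {i j : Fin n} (hj : j ≠ i) :
    ViewEdge (relView x c i) (x j - x i) ↔ OnEdge x i j := by
  simp only [ViewEdge, OnEdge, forall_relView]
  constructor
  · rintro ⟨-, u, hu, h1, h2⟩
    exact ⟨u, hu, h1, dot_nonneg_of_visible hx h2⟩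
  · rintro ⟨u, hu, h1, h2⟩
    exact ⟨fun h => hj (hx (sub_eq_zero.1 h)), u, hu, h1, fun k _ => h2 k⟩

theorem viewLine_iff (hx : Function.Injective x) (i : Fin n) (y : Plane) :
    ViewLine (relView x c i) y ↔ y ≠ 0 ∧ ∀ j, dot y (x j - x i) = 0 := by
  simp only [ViewLine, forall_relView]
  refine and_congr_right fun _ => ⟨fun h j => ?_, fun h j _ => h j⟩
  have h1 := dot_nonneg_of_visible hx (fun j hj => (h j hj).ge) j
  have h2 := dot_nonneg_of_visible (u := -y) hx
    (fun j hj => by rw [neg_dot, h j hj, neg_zero]) j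
  rw [neg_dot] at h2
  linarith

theorem Flat.of_dot_eq_zero {y : Plane} {i : Fin n} (hy : y ≠ 0)
    (h : ∀ j, dot y (x j - x i) = 0) : Flat x := by
  refine ⟨y, hy, fun k j => ?_⟩
  have h1 := h j
  have h2 := h k
  rw [dot_sub] at *
  linarith

/-- Colors make up for hidden agents: the obstructing agent cannot be a corner, so it is unlit and
not closer to the edge than the observer; the same then holds for the agent behind it. -/
theorem DropVec.of_viewDrop (hI : ConfigInv x c) {i : Fin n} {y : Plane}
    (h : ViewDrop (relView x c i) y) : ∃ a b τ, DropVec x i a b τ y := by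
  simp only [ViewDrop, exists_relView, forall_relView] at h
  obtain ⟨h0, a, -, b, -, ha, hb, hab, ⟨τ, hτ0, hτ1, e⟩, hperp, h1, h2⟩ := h
  have hid : ∀ j, ¬ Visible x i j → dot y (x j - x i) ≤ 0 := by
    intro j hv
    by_cases hj : j = i
    · rw [hj, sub_self, dot_zero]
    obtain ⟨k, hk, hvis, θ, hθ, hθ1, ek⟩ := exists_visible_toward hI.inj hj
    have hkj : k ≠ j := by rintro rfl; exact hv hvis
    have h3 : ¬ Lit (c k) := by
      intro hl
      refine (hI.corner k hl).notMem_segment hk hkj ?_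
      rw [segment_eq_image']
      exact ⟨θ, ⟨hθ.le, hθ1⟩, by simp [← ek]⟩
    have h4 := h2 k hvis h3
    rw [ek, dot_smul] at h4
    exact nonpos_of_mul_nonpos_right h4 hθ
  refine ⟨a, b, τ, h0, hI.corner a ha, hI.corner b hb, ?_, hτ0, hτ1, e, ?_, ?_, ?_⟩
  · rintro rfl; exact hab rfl
  · rwa [sub_sub_sub_cancel_right] at hperp
  · intro j
    by_cases hv : Visible x i j
    · exact h1 j hv
    · exact (hid j hv).trans (dot_self_nonneg y)
  · intro j hj
    by_cases hv : Visible x i j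
    · exact h2 j hv (fun hl => hj (hI.corner j hl))
    · exact hid j hv

/-- An interrupted slide is a slide with smaller ratio. Hidden agents lie farther along the rays
than visible ones, so the bound on the length extends to them. -/
theorem SlideMove.of_viewSlide (hδ : 0 < δ) (hI : ConfigInv x c) {i : Fin n} {y v : Plane}
    (hc : Corner x i) (h : ViewSlide (relView x c i) y) (hv : PartialMove δ y v) :
    ∃ e f r, SlideMove x c i e f r v := by
  simp only [ViewSlide, exists_relView, forall_relView] at h
  obtain ⟨e, hve, f, hvf, hl, he, hf, hef, r, hr, rfl, hshort⟩ := h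
  obtain ⟨s, hs0, hs1, rfl, -⟩ := hv.pos hδ
  have hei : e ≠ i := by rintro rfl; exact he.1 (sub_self _)
  have hfi : f ≠ i := by rintro rfl; exact hf.1 (sub_self _)
  refine ⟨e, f, s * r, hc, hei, hfi, ?_, hve, hvf, hl, (viewEdge_iff hI.inj hei).1 he,
    (viewEdge_iff hI.inj hfi).1 hf, by positivity, by rw [smul_smul], fun j hj => ?_⟩
  · rintro rfl; exact hef rfl
  by_cases hji : j = i
  · rw [hji, sub_self, dot_zero] at hj
    exact absurd hj (lt_irrefl _)
  obtain ⟨k, hk, hvis, θ, hθ, hθ1, ek⟩ := exists_visible_toward hI.inj hji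
  have h1 := hshort k hvis (by rw [ek, dot_smul]; positivity)
  rw [ek, dot_smul] at h1
  have h2 := dot_self_pos hf.1
  have h3 : s * r ≤ r := by nlinarith
  nlinarith

/-- The geometric lemmas on single rounds below use only this list of displacements, not the rules.
-/
theorem Step.displacement (hδ : 0 < δ) (hI : ConfigInv x c) (h : Step δ act x c x' c') (i : Fin n) :
    Displacement δ x c i (x' i - x i) := by
  by_cases ha : i ∈ act
  swap
  · exact .stay (by rw [((h i).1 ha).1, sub_self])
  obtain ⟨y, hv, hr⟩ := (h i).2 ha
  have h0 : PartialMove δ 0 (x' i - x i) → Displacement δ x c i (x' i - x i) := by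
    rintro ⟨s, -, -, e, -⟩
    exact .stay (by rw [e, smul_zero])
  generalize hci : c i = ci at hr
  generalize c' i = ci' at hr
  cases hr with
  | red => exact h0 hv
  | finish _ => exact h0 hv
  | slide y _ hs =>
    obtain ⟨e, f, r, h1⟩ := SlideMove.of_viewSlide hδ hI (hI.corner i (Or.inr hci)) hs hv
    exact .slide e f r h1
  | wait _ _ => exact h0 hv
  | light _ _ _ => exact h0 hv
  | leaveLine _ y _ hc hl =>
    rw [viewCorner_iff hI.inj] at hc
    obtain ⟨hy, hl⟩ := (viewLine_iff hI.inj i y).1 hl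
    obtain ⟨s, hs0, hs1, e, -⟩ := hv.pos hδ
    refine .leaveLine hc ?_ fun j => ?_
    · rw [e]; exact smul_ne_zero hs0.ne' hy
    · rw [e, smul_dot, hl, mul_zero]
  | drop _ y _ hc _ hi hd =>
    rw [viewCorner_iff hI.inj] at hc
    rw [viewInterior_iff hI.inj] at hi
    obtain ⟨a, b, τ, h1⟩ := DropVec.of_viewDrop hI hd.1
    obtain ⟨s, hs0, hs1, e, h2⟩ := hv.pos hδ
    exact .drop a b τ y s hc hi h1 hs0 hs1 e h2 hd
  | idle _ _ _ _ _ => exact h0 hv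

/-! #### Single displacements -/

/-- A corner has all others in an open half-plane and sees at most one agent on each ray. -/
theorem SlideMove.cross_ne_zero (hx : Function.Injective x) {i e f : Fin n} {r : ℝ} {v : Plane}
    (h : SlideMove x c i e f r v) : cross (x e - x i) (x f - x i) ≠ 0 := by
  intro h0
  have he : x e - x i ≠ 0 := fun h1 => h.ne_left (hx (sub_eq_zero.1 h1))
  obtain ⟨θ, hθ⟩ : ∃ θ : ℝ, x f - x i = θ • (x e - x i) := ⟨_, exists_smul_of_cross_eq_zero he h0⟩
  obtain ⟨w, hw⟩ := h.corner
  have h1 := hw e h.ne_left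
  have h2 := hw f h.ne_right
  rw [hθ, dot_smul] at h2
  have hθ0 : 0 < θ := pos_of_mul_pos_left h2 h1.le
  rcases lt_trichotomy θ 1 with h3 | h3 | h3
  · exact not_visible_of_between hx h.ne_right h3 hθ0.le hθ h.visible_left
  · rw [h3, one_smul, sub_left_inj] at hθ
    exact h.ne (hx hθ).symm
  · refine not_visible_of_between hx h.ne_left (inv_lt_one_of_one_lt₀ h3) (inv_pos.2 hθ0).le ?_
      h.visible_right
    rw [hθ, smul_smul, inv_mul_cancel₀ hθ0.ne', one_smul]

theorem SlideMove.not_flat (hx : Function.Injective x) {i e f : Fin n} {r : ℝ} {v : Plane}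
    (h : SlideMove x c i e f r v) : ¬ Flat x := fun ⟨_, hy, hd⟩ =>
  h.cross_ne_zero hx (cross_eq_zero_of_dot_eq_zero hy (hd i e) (hd i f))

theorem SlideMove.sub_ne_zero (hx : Function.Injective x) {i e f : Fin n} {r : ℝ} {v : Plane}
    (h : SlideMove x c i e f r v) : x f - x i ≠ 0 :=
  fun h1 => h.ne_right (hx (_root_.sub_eq_zero.1 h1))

/-- The target is itself ahead, so `short` applies to it. The bound by one half lets two corners
slide towards each other along one edge without meeting. -/
theorem SlideMove.lt_half (hx : Function.Injective x) {i e f : Fin n} {r : ℝ} {v : Plane}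
    (h : SlideMove x c i e f r v) : r < 1 / 2 := by
  have h1 := dot_self_pos (h.sub_ne_zero hx)
  have h2 := h.short f h1
  by_contra! h3
  nlinarith

theorem DropVec.dot_left {i a b : Fin n} {τ : ℝ} {y : Plane} (h : DropVec x i a b τ y) :
    dot y (x a - x i) = dot y y := by
  have h1 : y = (x a - x i) + τ • (x b - x a) := by
    rw [h.eq]; module
  conv_rhs => rw [h1, dot_add, dot_smul]
  rw [← h1, h.perp, mul_zero, add_zero]

/-- Positions after a slide, seen from a reference point. -/
theorem SlideMove.dot_pos {i e f : Fin n} {r : ℝ} (h : SlideMove x c i e f r (x' i - x i))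
    (u o : Plane) : dot u (x' i - o) = (1 - r) * dot u (x i - o) + r * dot u (x f - o) := by
  rw [← dot_smul, ← dot_smul, ← dot_add]
  congr 1
  rw [← sub_add_cancel (x' i) (x i), h.eq]
  module

/-- Positions after a drop, seen from a reference point. -/
theorem DropVec.dot_pos {i a b : Fin n} {τ s : ℝ} {y : Plane} (h : DropVec x i a b τ y)
    (hs : x' i - x i = s • y) (u o : Plane) :
    dot u (x' i - o) = (1 - s) * dot u (x i - o) +
      s * ((1 - τ) * dot u (x a - o) + τ * dot u (x b - o)) := by
  rw [← dot_smul, ← dot_smul, ← dot_smul, ← dot_add, ← dot_smul, ← dot_add]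
  congr 1
  rw [← sub_add_cancel (x' i) (x i), hs, h.eq]
  module

/-- The hull shrinks. -/
theorem le_dot_of_displacement (hx : Function.Injective x) (hf : ¬ Flat x)
    (h : ∀ i, Displacement δ x c i (x' i - x i)) (u o : Plane)
    (hu : ∀ j, 0 ≤ dot u (x j - o)) (i : Fin n) : 0 ≤ dot u (x' i - o) := by
  -- Without collinearity every new position is a convex combination of old ones.
  cases h i with
  | stay h => rw [sub_eq_zero.1 h]; exact hu i
  | slide e f r h =>
    rw [h.dot_pos]
    have h1 := h.lt_half hx
    have h2 := h.pos
    have := hu i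
    have := hu f
    have : 0 ≤ 1 - r := by linarith
    positivity
  | leaveLine _ h1 h2 => exact absurd (Flat.of_dot_eq_zero h1 h2) hf
  | drop a b τ y s _ _ h hs0 hs1 e _ =>
    rw [h.dot_pos e]
    have := hu i
    have := hu a
    have := hu b
    have := h.pos
    have : 0 ≤ 1 - s := by linarith
    have : 0 ≤ 1 - τ := by linarith [h.lt_one]
    positivity

/-- Since `i` is a corner, all other agents on its supporting line are on the side of `f`, so
`short` applies to them. -/
theorem SlideMove.dot_of_onLine (hx : Function.Injective x) {i e f : Fin n} {r : ℝ} {v u : Plane}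
    (h : SlideMove x c i e f r v) (hu : u ≠ 0) (huf : dot u (x f - x i) = 0) {j : Fin n}
    (hj : j ≠ i) (h0 : dot u (x j - x i) = 0) :
    2 * r * dot (x f - x i) (x f - x i) < dot (x f - x i) (x j - x i) := by
  apply h.short
  have hf := h.sub_ne_zero hx
  have hj' := exists_smul_of_dot_eq_zero hu hf huf h0
  obtain ⟨w, hw⟩ := h.corner
  have h1 := hw j hj
  rw [hj', dot_smul] at h1
  have h2 := pos_of_mul_pos_left h1 (hw f h.ne_right).le
  exact (div_pos_iff_of_pos_right (dot_self_pos hf)).1 h2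

theorem Interior.dot_pos {j : Fin n} (h : Interior x j) {u o : Plane} (hu : u ≠ 0)
    (hk : ∀ k, 0 ≤ dot u (x k - o)) : 0 < dot u (x j - o) := by
  obtain ⟨k, h1⟩ := h u hu
  have h2 := hk k
  rw [dot_sub] at *
  linarith

/-! #### Corners persist -/

/-- The old direction still separates: each new position is a convex combination of old ones with
positive weight on an agent other than `i`. -/
theorem Corner.of_displacement_of_stay (hx : Function.Injective x) (hf : ¬ Flat x)
    (h : ∀ i, Displacement δ x c i (x' i - x i)) {i : Fin n} (hc : Corner x i)
    (hi : x' i = x i) : Corner x' i := by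
  obtain ⟨v, hv⟩ := hc
  have hv' : ∀ j, 0 ≤ dot v (x j - x i) := by
    intro j
    by_cases hj : j = i
    · rw [hj, sub_self, dot_zero]
    · exact (hv j hj).le
  refine ⟨v, fun j hj => ?_⟩
  rw [hi]
  have h0 := hv j hj
  cases h j with
  | stay h => rwa [sub_eq_zero.1 h]
  | slide e f r h =>
    rw [h.dot_pos]
    have h1 := h.lt_half hx
    have := h.pos
    have := hv' f
    have : 0 < 1 - r := by linarith
    positivity
  | leaveLine _ h1 h2 => exact absurd (Flat.of_dot_eq_zero h1 h2) hf
  | drop a b τ y s _ _ h hs0 hs1 e _ =>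
    rw [h.dot_pos e]
    have ha := hv' a
    have hb := hv' b
    have := h.pos
    have : 0 ≤ 1 - s := by linarith
    have : 0 < 1 - τ := by linarith [h.lt_one]
    -- The ends of the edge are distinct, so at most one of them is `i`.
    have h3 : 0 < (1 - τ) * dot v (x a - x i) + τ * dot v (x b - x i) := by
      by_cases hai : a = i
      · have := hv b (by rw [← hai]; exact h.ne.symm)
        positivity
      · have := hv a hai
        positivity
    positivity

/-- The slide stays on the supporting line through `f`, so it suffices that `i` remains strictly
last on this line among the agents that are there after the round. -/
theorem Corner.of_displacement_of_slide (hx : Function.Injective x) (hf : ¬ Flat x)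
    (h : ∀ i, Displacement δ x c i (x' i - x i)) {i e f : Fin n} {r : ℝ}
    (hs : SlideMove x c i e f r (x' i - x i)) : Corner x' i := by
  obtain ⟨u, hu, huf, hu0⟩ := hs.edge_right
  have hD := dot_self_pos (hs.sub_ne_zero hx)
  have hr := hs.pos
  have hline := fun j => hs.dot_of_onLine hx hu huf (j := j)
  have hline' : ∀ j, dot u (x j - x i) = 0 → 0 ≤ dot (x f - x i) (x j - x i) := by
    intro j hj
    by_cases hji : j = i
    · rw [hji, sub_self, dot_zero]
    · exact le_trans (by positivity) (hline j hji hj).le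
  refine corner_of_lex u (x f - x i) fun j hj => ?_
  have e0 : ∀ w, dot w (x' j - x' i) = dot w (x' j - x i) - r * dot w (x f - x i) := by
    intro w
    rw [← dot_smul, ← dot_sub, ← hs.eq]
    congr 1; abel
  rw [e0, e0, huf, mul_zero, sub_zero]
  rcases (le_dot_of_displacement hx hf h u (x i) hu0 j).lt_or_eq with h1 | h1
  · exact Or.inl h1
  refine Or.inr ⟨h1.symm, ?_⟩
  have hrD := mul_pos hr hD
  cases h j with
  | stay h =>
    rw [sub_eq_zero.1 h] at h1 ⊢
    have := hline j hj h1.symm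
    linarith
  -- On the line, `j` was ahead by more than twice the slide of `i`, and it keeps more than half of
  -- this lead since `r' < 1 / 2`.
  | slide e' f' r' h =>
    rw [h.dot_pos] at h1 ⊢
    have h2 := h.lt_half hx
    have h3 := h.pos
    have h4 := mul_nonneg (by linarith : 0 ≤ 1 - r') (hu0 j)
    have h5 := mul_nonneg h3.le (hu0 f')
    have h6 : dot u (x j - x i) = 0 :=
      (mul_eq_zero.1 (by linarith : (1 - r') * dot u (x j - x i) = 0)).resolve_left (by linarith)
    have h7 : dot u (x f' - x i) = 0 :=
      (mul_eq_zero.1 (by linarith : r' * dot u (x f' - x i) = 0)).resolve_left h3.ne'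
    have h8 := hline j hj h6
    have h9 := mul_nonneg h3.le (hline' f' h7)
    nlinarith
  | leaveLine _ h1 h2 => exact absurd (Flat.of_dot_eq_zero h1 h2) hf
  -- A drop meets the line only if it is complete and its edge lies on the line. It is then
  -- perpendicular to the line and does not change the lead of `j`.
  | drop a b τ y s _ hint h hs0 hs1 e _ =>
    rw [h.dot_pos e] at h1
    have hτ := h.pos
    have hτ1 : 0 < 1 - τ := by linarith [h.lt_one]
    have hj0 := hint.dot_pos hu hu0
    have ha := mul_nonneg hτ1.le (hu0 a)
    have hb := mul_nonneg hτ.le (hu0 b)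
    have h2 := mul_nonneg hs0.le (add_nonneg ha hb)
    have h3 := mul_nonneg (by linarith : 0 ≤ 1 - s) hj0.le
    have hs1' : 1 - s = 0 := (mul_eq_zero.1 (by linarith :
      (1 - s) * dot u (x j - x i) = 0)).resolve_right hj0.ne'
    have hs1'' : s = 1 := by linarith
    subst hs1''
    have ha0 : dot u (x a - x i) = 0 :=
      (mul_eq_zero.1 (by linarith : (1 - τ) * dot u (x a - x i) = 0)).resolve_left hτ1.ne'
    have hb0 : dot u (x b - x i) = 0 :=
      (mul_eq_zero.1 (by linarith : τ * dot u (x b - x i) = 0)).resolve_left hτ.ne'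
    have hab : x b - x a ≠ 0 := fun h0 => h.ne (hx (sub_eq_zero.1 h0)).symm
    have hab0 : dot u (x b - x a) = 0 := by
      rw [← sub_sub_sub_cancel_right _ _ (x i), dot_sub, ha0, hb0, sub_zero]
    have hfy : dot (x f - x i) y = 0 := by
      rw [exists_smul_of_dot_eq_zero hu hab hab0 huf, smul_dot, dot_comm _ y, h.perp, mul_zero]
    have h4 : dot (x f - x i) (x' j - x i) = dot (x f - x i) (x j - x i) := by
      rw [← sub_add_cancel (x' j) (x j), e, one_smul, add_sub_assoc, dot_add, hfy, zero_add]
    have h5 : 0 < dot (x f - x i) (x' j - x i) := by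
      rw [h.dot_pos e]
      have h6 := hline' a ha0
      have h7 := hline' b hb0
      by_cases hai : a = i
      · have h8 := hline b (by rw [← hai]; exact h.ne.symm) hb0
        have : 0 < dot (x f - x i) (x b - x i) := lt_trans (by positivity) h8
        nlinarith [mul_pos hτ this, mul_nonneg hτ1.le h6]
      · have h8 := hline a hai ha0
        have : 0 < dot (x f - x i) (x a - x i) := lt_trans (by positivity) h8
        nlinarith [mul_pos hτ1 this, mul_nonneg hτ.le h7]
    rw [h4] at h5 ⊢
    have := hs.short j h5
    linarith

/-- An unlit boundary neighbor of a sliding corner becomes a corner. -/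
theorem SlideMove.exposes (hx : Function.Injective x) (hf : ¬ Flat x)
    (h : ∀ i, Displacement δ x c i (x' i - x i)) {i e f : Fin n} {r : ℝ}
    (hs : SlideMove x c i e f r (x' i - x i)) (he : ¬ Corner x e) : Corner x' e := by
  obtain ⟨u, hu, hue, hu0⟩ := hs.edge_left
  have hd : x e - x i ≠ 0 := fun h1 => hs.ne_left (hx (sub_eq_zero.1 h1))
  have hD := dot_self_pos hd
  have hue' : ∀ z, dot u (z - x e) = dot u (z - x i) := by
    intro z
    rw [dot_sub] at hue
    rw [dot_sub, dot_sub]; linarith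
  have hstay : x' e = x e := by
    -- On a supporting line and not a corner, `e` can neither drop nor slide; this is why drops are
    -- reserved to interior agents.
    cases h e with
    | stay h => exact sub_eq_zero.1 h
    | slide _ _ _ h => exact absurd h.corner he
    | leaveLine _ h1 h2 => exact absurd (Flat.of_dot_eq_zero h1 h2) hf
    | drop a b τ y s _ hint => exact absurd hue (hint.dot_pos hu hu0).ne'
  have hline : ∀ j, j ≠ i → j ≠ e → dot u (x j - x i) = 0 →
      ∃ θ : ℝ, 1 < θ ∧ x j - x i = θ • (x e - x i) := by
    intro j hji hje hj
    obtain ⟨θ, hθ⟩ : ∃ θ : ℝ, x j - x i = θ • (x e - x i) :=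
      ⟨_, exists_smul_of_dot_eq_zero hu hd hue hj⟩
    refine ⟨θ, ?_, hθ⟩
    obtain ⟨w, hw⟩ := hs.corner
    have h1 := hw j hji
    rw [hθ, dot_smul] at h1
    have hθ0 : 0 < θ := pos_of_mul_pos_left h1 (hw e hs.ne_left).le
    by_contra! hθ1
    rcases hθ1.lt_or_eq with h2 | h2
    · exact not_visible_of_between hx hji h2 hθ0.le hθ hs.visible_left
    · rw [h2, one_smul, sub_left_inj] at hθ
      exact hje (hx hθ)
  have hline' : ∀ j, j ≠ i → j ≠ e → dot u (x j - x i) = 0 →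
      0 < dot (x e - x i) (x j - x e) := by
    intro j hji hje hj
    obtain ⟨θ, hθ1, hθ⟩ := hline j hji hje hj
    rw [← sub_sub_sub_cancel_right (x j) (x e) (x i), hθ, dot_sub, dot_smul]
    nlinarith
  refine corner_of_lex u (x e - x i) fun j hj => ?_
  rw [hstay, hue']
  rcases (le_dot_of_displacement hx hf h u (x i) hu0 j).lt_or_eq with h1 | h1
  · exact Or.inl h1
  refine Or.inr ⟨h1.symm, ?_⟩
  -- The sliding corner leaves the line, because its two edges are not parallel.
  by_cases hji : j = i
  · subst hji
    exfalso
    rw [hs.eq, dot_smul] at h1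
    exact hs.cross_ne_zero hx (cross_eq_zero_of_dot_eq_zero hu hue
      ((mul_eq_zero.1 h1.symm).resolve_left hs.pos.ne'))
  cases h j with
  | stay h =>
    rw [sub_eq_zero.1 h] at h1 ⊢
    exact hline' j hji hj h1.symm
  | slide e' f' r' h =>
    rw [h.dot_pos] at h1 ⊢
    have h2 := h.lt_half hx
    have h3 := h.pos
    have h4 := mul_nonneg (by linarith : 0 ≤ 1 - r') (hu0 j)
    have h5 := mul_nonneg h3.le (hu0 f')
    have h6 : dot u (x j - x i) = 0 :=
      (mul_eq_zero.1 (by linarith : (1 - r') * dot u (x j - x i) = 0)).resolve_left (by linarith)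
    have h7 : dot u (x f' - x i) = 0 :=
      (mul_eq_zero.1 (by linarith : r' * dot u (x f' - x i) = 0)).resolve_left h3.ne'
    have h8 := mul_pos (by linarith : 0 < 1 - r') (hline' j hji hj h6)
    -- The target of `j` cannot be `i`, since `e` lies between them; so it is `e` or an agent beyond
    -- it.
    have h9 : 0 ≤ dot (x e - x i) (x f' - x e) := by
      by_cases hfi : f' = i
      · exfalso
        obtain ⟨θ, hθ1, hθ⟩ := hline j hji hj h6
        have hθ0 : 0 < θ := by linarith
        refine not_visible_of_between hx (i := j) (j := i) (k := e) (θ := (θ - 1) / θ) hj.symm ?_ ?_ ?_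
          (hfi ▸ h.visible_right)
        · rw [div_lt_one hθ0]; linarith
        · exact div_nonneg (by linarith) hθ0.le
        · rw [← neg_sub (x j) (x i), ← sub_sub_sub_cancel_right _ _ (x i), hθ, ← smul_neg,
            smul_smul, div_mul_cancel₀ _ hθ0.ne']
          module
      by_cases hfe : f' = e
      · rw [hfe, sub_self, dot_zero]
      · exact (hline' f' hfi hfe h7).le
    have := mul_nonneg h3.le h9
    linarith
  | leaveLine _ h1 h2 => exact absurd (Flat.of_dot_eq_zero h1 h2) hf
  | drop a b τ y s _ hint h hs0 hs1 es _ =>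
    -- A drop towards this line is excluded: `e` is no corner and would be closer to the target edge
    -- than the dropping agent.
    exfalso
    rw [h.dot_pos es] at h1
    have hτ := h.pos
    have hτ1 : 0 < 1 - τ := by linarith [h.lt_one]
    have hj0 := hint.dot_pos hu hu0
    have ha := mul_nonneg hτ1.le (hu0 a)
    have hb := mul_nonneg hτ.le (hu0 b)
    have h2 := mul_nonneg hs0.le (add_nonneg ha hb)
    have h3 := mul_nonneg (by linarith : 0 ≤ 1 - s) hj0.le
    have h4 : s * ((1 - τ) * dot u (x a - x i) + τ * dot u (x b - x i)) = 0 := by linarith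
    have h5 := (mul_eq_zero.1 h4).resolve_left hs0.ne'
    have ha0 : dot u (x a - x i) = 0 :=
      (mul_eq_zero.1 (by linarith : (1 - τ) * dot u (x a - x i) = 0)).resolve_left hτ1.ne'
    have hb0 : dot u (x b - x i) = 0 :=
      (mul_eq_zero.1 (by linarith : τ * dot u (x b - x i) = 0)).resolve_left hτ.ne'
    have hab : x b - x a ≠ 0 := fun h0 => h.ne (hx (sub_eq_zero.1 h0)).symm
    have hab0 : dot u (x b - x a) = 0 := by
      rw [← sub_sub_sub_cancel_right _ _ (x i), dot_sub, ha0, hb0, sub_zero]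
    have hea : dot u (x e - x a) = 0 := by
      rw [← sub_sub_sub_cancel_right _ _ (x i), dot_sub, ha0, hue, sub_zero]
    have hy : dot y (x e - x a) = 0 := by
      rw [exists_smul_of_dot_eq_zero hu hab hab0 hea, dot_smul, h.perp, mul_zero]
    have h6 := h.nearest _ he
    rw [← sub_add_sub_cancel _ (x a), dot_add, hy, h.dot_left, zero_add] at h6
    exact absurd (dot_self_pos h.ne_zero) (not_lt.2 h6)

/-! #### Agents that are not corners move apart -/

theorem Displacement.dot_nonpos (hf : ¬ Flat x) {i j : Fin n} {v : Plane}
    (h : Displacement δ x c i v) (hi : ¬ Corner x i) (hj : ¬ Corner x j) :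
    dot v (x j - x i) ≤ 0 := by
  cases h with
  | stay h => simp [h, dot]
  | slide _ _ _ h => exact absurd h.corner hi
  | leaveLine _ h1 h2 => exact absurd (Flat.of_dot_eq_zero h1 h2) hf
  | drop a b τ y s _ hint h hs0 hs1 e _ =>
    rw [e, smul_dot]
    exact mul_nonpos_of_nonneg_of_nonpos hs0.le (h.nearest j hj)

/-- In the expansion of the new squared distance, the two mixed terms of displacement and old
difference are nonnegative by `Displacement.dot_nonpos`. -/
theorem dist_le_of_displacement (hf : ¬ Flat x)
    (h : ∀ i, Displacement δ x c i (x' i - x i)) {i j : Fin n}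
    (hi : ¬ Corner x i) (hj : ¬ Corner x j) :
    dot (x j - x i) (x j - x i) +
      dot ((x' j - x j) - (x' i - x i)) ((x' j - x j) - (x' i - x i)) ≤
      dot (x' j - x' i) (x' j - x' i) := by
  have h1 := (h i).dot_nonpos hf hi hj
  have h2 := (h j).dot_nonpos hf hj hi
  simp only [dot, PiLp.sub_apply] at *
  nlinarith

/-! #### Collinear configurations -/

/-- Slides need two non-parallel edges and drops an interior agent; collinear agents have neither.
-/
theorem Flat.displacement (hx : Function.Injective x) (hf : Flat x) {i : Fin n} {v : Plane}
    (h : Displacement δ x c i v) :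
    v = 0 ∨ (¬ Corner x i ∧ v ≠ 0 ∧ ∀ j, dot v (x j - x i) = 0) := by
  cases h with
  | stay h => exact Or.inl h
  | slide _ _ _ h => exact absurd hf (h.not_flat hx)
  | leaveLine h0 h1 h2 => exact Or.inr ⟨h0, h1, h2⟩
  | drop a b τ y s _ hint h hs0 hs1 e _ =>
    exfalso
    obtain ⟨u, hu, h⟩ := hf
    obtain ⟨k, hk⟩ := hint u hu
    rw [h] at hk
    exact lt_irrefl _ hk

theorem exists_ne_of_not_corner {i : Fin n} (h : ¬ Corner x i) : ∃ j, j ≠ i := by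
  by_contra! h0
  exact h ⟨0, fun j hj => absurd (h0 j) hj⟩

/-- Displacements are orthogonal to the line, so the coordinate along it is kept. This gives
injectivity and the persistence of corners. -/
theorem Flat.dot_rot_eq (hx : Function.Injective x) {y : Plane} (hy : y ≠ 0)
    (hd : ∀ i j, dot y (x j - x i) = 0)
    (h : ∀ i, Displacement δ x c i (x' i - x i)) (i j : Fin n) :
    dot (rot y) (x' j - x' i) = dot (rot y) (x j - x i) := by
  have key : ∀ i, dot (rot y) (x' i - x i) = 0 := by
    intro i
    rcases Flat.displacement hx ⟨y, hy, hd⟩ (h i) with h1 | ⟨h1, -, h2⟩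
    · rw [h1, dot_zero]
    · obtain ⟨j, hj⟩ := exists_ne_of_not_corner h1
      have h3 : x j - x i ≠ 0 := fun h0 => hj (hx (sub_eq_zero.1 h0))
      rw [rot_dot]
      exact cross_eq_zero_of_dot_eq_zero h3 (by rw [dot_comm, hd]) (by rw [dot_comm, h2])
  have h1 := key i
  have h2 := key j
  rw [dot_sub] at h1 h2
  rw [dot_sub, dot_sub]
  linarith

theorem Flat.injective (hx : Function.Injective x) (hf : Flat x)
    (h : ∀ i, Displacement δ x c i (x' i - x i)) : Function.Injective x' := by
  obtain ⟨y, hy, hd⟩ := hf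
  intro i j hij
  have h1 := Flat.dot_rot_eq hx hy hd h i j
  rw [hij, sub_self, dot_zero] at h1
  exact (hx (sub_eq_zero.1 (eq_zero_of_dot_rot hy (hd i j) h1.symm))).symm

theorem Flat.corner (hx : Function.Injective x) (hf : Flat x)
    (h : ∀ i, Displacement δ x c i (x' i - x i)) {i : Fin n} (hc : Corner x i) : Corner x' i := by
  obtain ⟨y, hy, hd⟩ := hf
  obtain ⟨v, hv⟩ := hc
  -- Up to a positive factor, this is the component of `v` along the line; it alone matters for the
  -- old positions.
  refine ⟨dot (rot y) v • rot y, fun j hj => ?_⟩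
  rw [smul_dot, Flat.dot_rot_eq hx hy hd h i j]
  have h1 : dot y y * dot v (x j - x i) = dot y v * dot y (x j - x i) +
      dot (rot y) v * dot (rot y) (x j - x i) := by
    simp only [rot_dot]
    simp only [dot, cross]
    ring
  rw [hd, mul_zero, zero_add] at h1
  rw [← h1]
  exact mul_pos (dot_self_pos hy) (hv j hj)

/-- When a collinear configuration changes, a new corner appears. -/
theorem Flat.exists_new_corner (hx : Function.Injective x) (hf : Flat x)
    (h : ∀ i, Displacement δ x c i (x' i - x i)) {p : Fin n} (hp : x' p ≠ x p) :
    ∃ k, ¬ Corner x k ∧ Corner x' k := by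
  rcases hf.displacement hx (h p) with h1 | ⟨-, h1, h2⟩
  · exact absurd (sub_eq_zero.1 h1) hp
  -- A corner farthest in the direction of the displacement of `p` is off the line, whereas old
  -- corners have not moved.
  have hu : -(x' p - x p) ≠ 0 := neg_ne_zero.2 h1
  obtain ⟨a, ha, hmin⟩ := exists_corner_minimizing (hf.injective hx h) _ hu p
  refine ⟨a, fun hc => ?_, ha⟩
  have h3 : x' a = x a := by
    rcases hf.displacement hx (h a) with h4 | ⟨h4, -⟩
    · exact sub_eq_zero.1 h4
    · exact absurd hc h4
  have h4 := hmin p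
  have h5 := h2 a
  have h6 := dot_self_pos h1
  rw [neg_dot, neg_dot, h3] at h4
  rw [dot_sub] at h5
  rw [dot_sub (x' p - x p)] at h6
  linarith

/-! #### The invariant -/

theorem Step.corner (hδ : 0 < δ) (hI : ConfigInv x c) (h : Step δ act x c x' c') {i : Fin n}
    (hc : Corner x i) : Corner x' i := by
  have hd := h.displacement hδ hI
  by_cases hf : Flat x
  · exact hf.corner hI.inj hd hc
  cases hd i with
  | stay h => exact hc.of_displacement_of_stay hI.inj hf hd (sub_eq_zero.1 h)
  | slide e f r h => exact Corner.of_displacement_of_slide hI.inj hf hd h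
  | leaveLine h _ _ => exact absurd hc h
  | drop a b τ y s h => exact absurd hc h

theorem Step.inv (hδ : 0 < δ) (hI : ConfigInv x c) (h : Step δ act x c x' c') : ConfigInv x' c' := by
  have hd := h.displacement hδ hI
  constructor
  · by_cases hf : Flat x
    · exact hf.injective hI.inj hd
    intro i j hij
    by_contra hne
    -- A corner shares its position with nobody, so colliding agents were not corners; but such
    -- agents never approach each other.
    have hi : ¬ Corner x i := fun hc => hne ((h.corner hδ hI hc).eq_of_pos_eq hij)
    have hj : ¬ Corner x j := fun hc => hne ((h.corner hδ hI hc).eq_of_pos_eq hij.symm).symm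
    have h1 := dist_le_of_displacement hf hd hi hj
    rw [hij, sub_self, dot_zero] at h1
    have h2 := dot_self_pos (a := x j - x i) (fun h0 => hne (hI.inj (sub_eq_zero.1 h0)).symm)
    have h3 := dot_self_nonneg ((x' j - x j) - (x' j - x i))
    linarith
  · intro i hl
    refine h.corner hδ hI ?_
    by_cases ha : i ∈ act
    · obtain ⟨y, -, hr⟩ := (h i).2 ha
      generalize hci : c i = ci at hr
      generalize c' i = ci' at hr hl
      cases hr with
      | red => exact hI.corner i (Or.inl hci)
      | finish _ => exact hI.corner i (Or.inr hci)
      | slide y _ hs => exact hI.corner i (Or.inr hci)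
      | wait _ _ => exact hI.corner i (Or.inr hci)
      | light _ _ h1 => exact (viewCorner_iff hI.inj i).1 h1
      | leaveLine _ y h1 => exact absurd hl h1
      | drop _ y h1 => exact absurd hl h1
      | idle _ h1 => exact absurd hl h1
    · exact hI.corner i (((h i).1 ha).2 ▸ hl)

end Moves

/-! ### The agent nearest to the boundary -/

/-- Expansion in the orthogonal basis `u`, `d`, cleared of the denominator `dot d d`. -/
theorem dot_decomposition {u d : Plane} (hu : dot u u = 1) (hd : dot u d = 0) (v q : Plane) :
    dot v q * dot d d = dot v u * dot u q * dot d d + dot v d * dot d q := by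
  have h1 : cross u d * cross u d = dot d d := by
    have : cross u d * cross u d = dot u u * dot d d - dot u d * dot u d := by
      simp only [dot, cross]; ring
    rw [this, hu, hd]; ring
  have h2 : ∀ z, dot u u * dot d z = dot u d * dot u z + cross u d * cross u z := by
    intro z; simp only [dot, cross]; ring
  have h3 : dot u u * dot v q = dot v u * dot u q + cross u v * cross u q := by
    simp only [dot, cross]; ring
  have h4 := h2 v
  have h5 := h2 q
  rw [hu, hd] at h4 h5
  rw [hu] at h3
  rw [dot_comm v d]
  linear_combination dot d d * h3 - (cross u v * cross u q) * h1 - dot d q * h4 -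
    (cross u d * cross u v) * h5

/-- If the foot of `q` on an edge falls at or behind its endpoint, the line of the adjacent edge is
strictly nearer: the `u`-part shrinks because `dot u' u < 1`, and the `d`-part is not positive. -/
theorem dot_lt_of_obtuse {u u' d q : Plane} (hu : dot u u = 1) (hu' : dot u' u' = 1)
    (hd : dot u d = 0) (hd' : 0 < dot u' d) (hq : 0 < dot u q) (h : dot q d ≤ 0) :
    dot u' q < dot u q := by
  have hd0 : d ≠ 0 := by rintro rfl; rw [dot_zero] at hd'; exact lt_irrefl _ hd'
  have hD := dot_self_pos hd0
  have h1 := dot_decomposition hu hd u' q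
  have h2 := dot_decomposition hu hd u' u'
  rw [dot_comm d q] at h1
  rw [hu', dot_comm d u', dot_comm u u'] at h2
  have h3 : dot u' u < 1 := by
    by_contra! h4
    nlinarith [mul_pos hd' hd', mul_le_mul h4 h4 zero_le_one (zero_le_one.trans h4)]
  have h4 := mul_nonneg hd'.le (neg_nonneg.2 h)
  have h5 : dot u' q * dot d d < dot u q * dot d d := by
    nlinarith [mul_pos (mul_pos (sub_pos.2 h3) hq) hD]
  exact lt_of_mul_lt_mul_right h5 hD.le

section Nearest

variable {n : ℕ} {x x' : Fin n → Plane} {c c' : Fin n → Fin 5} {δ : ℝ}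

/-- The agent `p` is no corner, and the line through the corners `a` and `b` supports the hull and
has the inner unit normal vector `u`. -/
structure EdgeData (x : Fin n → Plane) (p a b : Fin n) (u : Plane) : Prop where
  not_corner : ¬ Corner x p
  corner_left : Corner x a
  corner_right : Corner x b
  ne : a ≠ b
  unit : dot u u = 1
  perp : dot u (x b - x a) = 0
  supporting : ∀ j, 0 ≤ dot u (x j - x a)

/-- The agent `p` is nearest to the boundary of the hull, and the edge between `a` and `b` is
nearest to it. -/
structure NearestData (x : Fin n → Plane) (p a b : Fin n) (u : Plane) : Prop extends
    EdgeData x p a b u where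
  le : ∀ p' a' b' u', EdgeData x p' a' b' u' → dot u (x p - x a) ≤ dot u' (x p' - x a')

theorem EdgeData.ne_zero {p a b : Fin n} {u : Plane} (h : EdgeData x p a b u) : u ≠ 0 := by
  rintro rfl
  have := h.unit
  rw [dot_zero] at this
  exact zero_ne_one this

theorem EdgeData.sub_eq {p a b : Fin n} {u : Plane} (h : EdgeData x p a b u) (z : Plane) :
    dot u (z - x b) = dot u (z - x a) := by
  have := h.perp
  rw [dot_sub] at *
  rw [dot_sub]
  linarith

theorem EdgeData.swap {p a b : Fin n} {u : Plane} (h : EdgeData x p a b u) :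
    EdgeData x p b a u where
  not_corner := h.not_corner
  corner_left := h.corner_right
  corner_right := h.corner_left
  ne := h.ne.symm
  unit := h.unit
  perp := by rw [← neg_sub, dot_neg, h.perp, neg_zero]
  supporting j := by rw [h.sub_eq]; exact h.supporting j

theorem NearestData.swap {p a b : Fin n} {u : Plane} (h : NearestData x p a b u) :
    NearestData x p b a u where
  toEdgeData := h.toEdgeData.swap
  le p' a' b' u' h' := by rw [h.sub_eq]; exact h.le p' a' b' u' h'

/-- A unit normal vector determines the distance from a line. -/
theorem abs_dot_eq {u d : Plane} (hu : dot u u = 1) (hd : dot u d = 0) (z : Plane) :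
    |dot u z| * ‖d‖ = |cross d z| := by
  have h1 : cross u d * cross u d = ‖d‖ * ‖d‖ := by
    have : cross u d * cross u d = dot u u * dot d d - dot u d * dot u d := by
      simp only [dot, cross]; ring
    rw [this, hu, hd, dot_self_eq_norm_sq]; ring
  have h2 : dot u u * cross d z = cross u z * dot u d - cross u d * dot u z := by
    simp only [dot, cross]; ring
  rw [hu, hd, mul_zero, zero_sub, one_mul] at h2
  rw [h2, abs_neg, abs_mul, mul_comm]
  congr 1
  rw [← abs_norm d]
  exact ((abs_eq_abs.2 (mul_self_eq_mul_self_iff.1 h1))).symm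

/-- Removes the normal vector, so that the minimum in `exists_nearest` runs over finitely many
triples. -/
theorem EdgeData.dot_eq {p a b : Fin n} {u : Plane} (hx : Function.Injective x)
    (h : EdgeData x p a b u) :
    dot u (x p - x a) = |cross (x b - x a) (x p - x a)| / ‖x b - x a‖ := by
  have h1 : x b - x a ≠ 0 := fun h0 => h.ne (hx (sub_eq_zero.1 h0)).symm
  rw [eq_div_iff (norm_ne_zero_iff.2 h1), ← abs_dot_eq h.unit h.perp,
    abs_of_nonneg (h.supporting p)]

theorem EdgeData.exists_nearest (hx : Function.Injective x) {p₀ a₀ b₀ : Fin n} {u₀ : Plane}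
    (h : EdgeData x p₀ a₀ b₀ u₀) : ∃ p a b u, NearestData x p a b u ∧
      dot u (x p - x a) ≤ dot u₀ (x p₀ - x a₀) := by
  classical
  let S : Finset (Fin n × Fin n × Fin n) := Finset.univ.filter fun s =>
    ∃ u, EdgeData x s.1 s.2.1 s.2.2 u
  obtain ⟨⟨p, a, b⟩, hs, hmin⟩ := S.exists_min_image
    (fun s => |cross (x s.2.2 - x s.2.1) (x s.1 - x s.2.1)| / ‖x s.2.2 - x s.2.1‖)
    ⟨(p₀, a₀, b₀), by simpa [S] using ⟨u₀, h⟩⟩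
  simp only [S, Finset.mem_filter, Finset.mem_univ, true_and, Prod.forall] at hs hmin
  obtain ⟨u, hu⟩ := hs
  have key : ∀ p' a' b' u', EdgeData x p' a' b' u' →
      dot u (x p - x a) ≤ dot u' (x p' - x a') := by
    intro p' a' b' u' h'
    rw [hu.dot_eq hx, h'.dot_eq hx]
    exact hmin p' a' b' ⟨u', h'⟩
  exact ⟨p, a, b, u, ⟨hu, key⟩, key _ _ _ _ h⟩

/-- In a configuration that is not collinear, there is an edge at every corner that is not on
a given line. -/
theorem Corner.exists_edge_not_on (hx : Function.Injective x) (hf : ¬ Flat x) {a b : Fin n}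
    (ha : Corner x a) (hab : b ≠ a) : ∃ f u, f ≠ a ∧ Visible x a f ∧ dot u u = 1 ∧
      dot u (x f - x a) = 0 ∧ (∀ j, 0 ≤ dot u (x j - x a)) ∧ 0 < dot u (x b - x a) := by
  have key : ∀ f, f ≠ a → Visible x a f → ∀ w, w ≠ 0 → dot w (x f - x a) = 0 →
      (∀ j, 0 ≤ dot w (x j - x a)) → 0 < dot w (x b - x a) → ∃ f u, f ≠ a ∧ Visible x a f ∧
      dot u u = 1 ∧ dot u (x f - x a) = 0 ∧ (∀ j, 0 ≤ dot u (x j - x a)) ∧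
      0 < dot u (x b - x a) := by
    intro f hfa hv w hw h1 h2 h3
    have hw' : 0 < ‖w‖⁻¹ := inv_pos.2 (norm_pos_iff.2 hw)
    refine ⟨f, ‖w‖⁻¹ • w, hfa, hv, ?_, ?_, fun j => ?_, ?_⟩
    · rw [smul_dot, dot_smul, dot_self_eq_norm_sq]
      have := (norm_pos_iff.2 hw).ne'
      field_simp
    · rw [smul_dot, h1, mul_zero]
    · rw [smul_dot]; exact mul_nonneg hw'.le (h2 j)
    · rw [smul_dot]; exact mul_pos hw' h3
  obtain ⟨f, hfa, hfv, hf0⟩ := ha.exists_left hx hab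
  obtain ⟨g, hga, hgv, hg0⟩ := ha.exists_right hx hab
  have hfn : x f - x a ≠ 0 := fun h0 => hfa (hx (sub_eq_zero.1 h0))
  have hgn : x g - x a ≠ 0 := fun h0 => hga (hx (sub_eq_zero.1 h0))
  have hbn : x b - x a ≠ 0 := fun h0 => hab (hx (sub_eq_zero.1 h0))
  by_cases h1 : 0 < cross (x f - x a) (x b - x a)
  · refine key f hfa hfv _ (rot_ne_zero hfn) ?_ ?_ (by rwa [rot_dot])
    · rw [rot_dot]; simp only [cross]; ring
    · intro j; rw [rot_dot]; exact hf0 j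
  by_cases h2 : cross (x g - x a) (x b - x a) < 0
  · refine key g hga hgv (-rot (x g - x a)) (neg_ne_zero.2 (rot_ne_zero hgn)) ?_ ?_
      (by rw [neg_dot, rot_dot]; linarith)
    · rw [neg_dot, rot_dot]; simp only [cross]; ring
    · intro j; rw [neg_dot, rot_dot]; linarith [hg0 j]
  -- Otherwise both extremal rays at `a` pass through `x b`, which squeezes all agents onto one
  -- line.
  exfalso
  have hfb : cross (x f - x a) (x b - x a) = 0 := le_antisymm (not_lt.1 h1) (hf0 b)
  have hgb : cross (x g - x a) (x b - x a) = 0 := le_antisymm (hg0 b) (not_lt.1 h2)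
  obtain ⟨w, hw⟩ := ha
  have hline : ∀ k, k ≠ a → cross (x k - x a) (x b - x a) = 0 →
      ∃ θ : ℝ, 0 < θ ∧ x b - x a = θ • (x k - x a) := by
    intro k hk h0
    have hkn : x k - x a ≠ 0 := fun h0 => hk (hx (sub_eq_zero.1 h0))
    have h3 := exists_smul_of_cross_eq_zero hkn h0
    refine ⟨_, ?_, h3⟩
    have h4 := hw b hab
    rw [h3, dot_smul] at h4
    exact pos_of_mul_pos_left h4 (hw k hk).le
  obtain ⟨θ, hθ, e⟩ := hline f hfa hfb
  obtain ⟨η, hη, e'⟩ := hline g hga hgb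
  refine hf (Flat.of_dot_eq_zero (i := a) (rot_ne_zero hbn) fun j => ?_)
  rw [rot_dot]
  apply le_antisymm
  · rw [e']
    have : cross (η • (x g - x a)) (x j - x a) = η * cross (x g - x a) (x j - x a) := by
      simp only [cross, PiLp.smul_apply, smul_eq_mul]; ring
    rw [this]
    exact mul_nonpos_of_nonneg_of_nonpos hη.le (hg0 j)
  · rw [e]
    have : cross (θ • (x f - x a)) (x j - x a) = θ * cross (x f - x a) (x j - x a) := by
      simp only [cross, PiLp.smul_apply, smul_eq_mul]; ring
    rw [this]
    exact mul_nonneg hθ.le (hf0 j)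

theorem Interior.not_on_edge {a f : Fin n} {u : Plane} (h : Interior x f) (hu : dot u u = 1)
    (h1 : dot u (x f - x a) = 0) (h2 : ∀ j, 0 ≤ dot u (x j - x a)) : False := by
  refine (h.dot_pos ?_ h2).ne' h1
  rintro rfl
  rw [dot_zero] at hu
  exact zero_ne_one hu

/-- The second agent on an edge at a corner lies on a supporting line, so it is not interior and
must be a corner. -/
theorem exists_edgeData (hx : Function.Injective x) (hf : ¬ Flat x)
    (hint : ∀ i, ¬ Corner x i → Interior x i) {p : Fin n} (hp : ¬ Corner x p) :
    ∃ a b u, EdgeData x p a b u := by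
  obtain ⟨a, ha, -⟩ := exists_corner_minimizing hx (rot !₂[1, 0])
    (rot_ne_zero (fun h => by simpa using congrArg (fun z : Plane => z 0) h)) p
  have hpa : p ≠ a := by rintro rfl; exact hp ha
  obtain ⟨b, u, hb, -, h1, h2, h3, -⟩ := ha.exists_edge_not_on hx hf hpa
  refine ⟨a, b, u, hp, ha, ?_, hb.symm, h1, h2, h3⟩
  by_contra hb'
  exact (hint b hb').not_on_edge h1 h2 h3

/-- The foot of the perpendicular to a nearest edge belongs to it. -/
theorem NearestData.dot_pos (hx : Function.Injective x) (hf : ¬ Flat x)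
    (hint : ∀ i, ¬ Corner x i → Interior x i) {p a b : Fin n} {u : Plane}
    (h : NearestData x p a b u) : 0 < dot (x p - x a) (x b - x a) := by
  by_contra! h0
  -- If the foot were not beyond `a`, the other edge at `a` would be strictly nearer.
  obtain ⟨f, w, hfa, -, hw, hwf, hw0, hwb⟩ := h.corner_left.exists_edge_not_on hx hf h.ne.symm
  have hfc : Corner x f := by
    by_contra hf'
    exact (hint f hf').not_on_edge hw hwf hw0
  have h1 := h.le p a f w ⟨h.not_corner, h.corner_left, hfc, hfa.symm, hw, hwf, hw0⟩
  exact absurd (dot_lt_of_obtuse h.unit hw h.perp hwb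
    ((hint p h.not_corner).dot_pos h.ne_zero h.supporting) h0) (not_lt.2 h1)

/-- An obstructing agent would be no corner and strictly closer to the line through `a` and `b`. -/
theorem NearestData.visible (hx : Function.Injective x)
    (hint : ∀ i, ¬ Corner x i → Interior x i) {p a b : Fin n} {u : Plane}
    (h : NearestData x p a b u) : Visible x p a := by
  intro k hkp hka hk
  have hkc : ¬ Corner x k := fun hc => hc.notMem_segment hkp hka hk
  have h1 := h.le k a b u
    ⟨hkc, h.corner_left, h.corner_right, h.ne, h.unit, h.perp, h.supporting⟩
  rw [segment_eq_image'] at hk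
  obtain ⟨θ, ⟨hθ0, -⟩, e⟩ := hk
  have h2 : x k - x a = (1 - θ) • (x p - x a) := by
    rw [← e]; module
  have hθ : 0 < θ := by
    rcases hθ0.lt_or_eq with h3 | h3
    · exact h3
    · rw [← h3] at e
      exact absurd (hx (by simpa using e.symm)) hkp
  rw [h2, dot_smul] at h1
  have h3 := (hint p h.not_corner).dot_pos h.ne_zero h.supporting
  nlinarith

/-- A drop vector yields a supporting line. -/
theorem DropVec.edgeData {i a b : Fin n} {τ : ℝ} {y : Plane} (h : DropVec x i a b τ y)
    (hi : ¬ Corner x i) : EdgeData x i a b (-(‖y‖⁻¹ • y)) ∧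
      dot (-(‖y‖⁻¹ • y)) (x i - x a) = ‖y‖ := by
  have hy := norm_pos_iff.2 h.ne_zero
  have h0 : ∀ z, dot (-(‖y‖⁻¹ • y)) z = -(‖y‖⁻¹ * dot y z) := fun z => by
    rw [neg_dot, smul_dot]
  have h1 := h.dot_left
  refine ⟨⟨hi, h.corner_left, h.corner_right, h.ne, ?_, ?_, fun j => ?_⟩, ?_⟩
  · rw [h0, dot_neg, dot_smul, dot_self_eq_norm_sq]
    field_simp
  · rw [h0, h.perp]; ring
  · rw [h0, ← mul_neg]
    have h2 := h.supporting j
    have h3 : dot y (x j - x a) = dot y (x j - x i) - dot y (x a - x i) := by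
      rw [← dot_sub, sub_sub_sub_cancel_right]
    have : 0 ≤ -dot y (x j - x a) := by rw [h3, h1]; linarith
    positivity
  · rw [h0, ← neg_sub, dot_neg, h1, dot_self_eq_norm_sq]
    field_simp

/-- A nearest agent has a drop vector. -/
theorem NearestData.exists_bestDrop (hI : ConfigInv x c) (hf : ¬ Flat x)
    (hint : ∀ i, ¬ Corner x i → Interior x i) (hl : ∀ i, Corner x i → Lit (c i))
    {p a b : Fin n} {u : Plane} (h : NearestData x p a b u) :
    ∃ y, ViewBestDrop (relView x c p) y ∧ ‖y‖ = dot u (x p - x a) := by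
  have hx := hI.inj
  have hpos := (hint p h.not_corner).dot_pos h.ne_zero h.supporting
  have hd : x b - x a ≠ 0 := fun h0 => h.ne (hx (sub_eq_zero.1 h0)).symm
  have hD := dot_self_pos hd
  obtain ⟨s, hs⟩ : ∃ s, s = dot u (x p - x a) := ⟨_, rfl⟩
  -- The parameter of the foot of the perpendicular from `p`.
  obtain ⟨τ, hτ⟩ : ∃ τ, τ = dot (x b - x a) (x p - x a) / dot (x b - x a) (x b - x a) := ⟨_, rfl⟩
  have hτ0 : 0 < τ := by
    rw [hτ, dot_comm (x b - x a)]
    exact div_pos (h.dot_pos hx hf hint) hD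
  have hτ1 : τ < 1 := by
    rw [hτ, div_lt_one hD]
    have := h.swap.dot_pos hx hf hint
    have e : dot (x p - x b) (x a - x b) =
        dot (x b - x a) (x b - x a) - dot (x b - x a) (x p - x a) := by
      simp only [dot, PiLp.sub_apply]; ring
    linarith
  have hy : (1 - τ) • (x a - x p) + τ • (x b - x p) = -(s • u) := by
    have h1 : (x p - x a) - s • u - τ • (x b - x a) = 0 := by
      have h2 : dot u ((x p - x a) - s • u - τ • (x b - x a)) = 0 := by
        rw [dot_sub, dot_sub, dot_smul, dot_smul, h.perp, h.unit, ← hs]; ring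
      rw [exists_smul_of_dot_eq_zero h.ne_zero hd h.perp h2, dot_sub, dot_sub, dot_smul, dot_smul,
        dot_comm (x b - x a) u, h.perp, hτ, div_mul_cancel₀ _ hD.ne', mul_zero, sub_zero, sub_self,
        zero_div, zero_smul]
    rw [← sub_eq_zero, ← neg_eq_zero, ← h1]
    module
  rw [← hs] at hpos ⊢
  have hdot : ∀ z, dot (-(s • u)) z = -(s * dot u z) := fun z => by rw [neg_dot, smul_dot]
  have hyy : dot (-(s • u)) (-(s • u)) = s ^ 2 := by
    rw [hdot, dot_neg, dot_smul, h.unit]; ring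
  have hnorm : ‖-(s • u)‖ = s := by
    rw [dot_self_eq_norm_sq] at hyy
    exact (sq_eq_sq₀ (norm_nonneg _) hpos.le).1 hyy
  refine ⟨-(s • u), ⟨?_, ?_⟩, hnorm⟩
  · simp only [ViewDrop, exists_relView, forall_relView]
    refine ⟨fun h0 => ?_, a, h.visible hx hint, b, h.swap.visible hx hint, hl a h.corner_left,
      hl b h.corner_right, fun h0 => h.ne (hx (sub_left_injective h0)), ⟨τ, hτ0, hτ1, hy.symm⟩, ?_,
      fun j _ => ?_, fun j _ hj => ?_⟩
    · rw [h0, norm_zero] at hnorm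
      exact hpos.ne hnorm
    · rw [sub_sub_sub_cancel_right, hdot, h.perp]; ring
    · rw [hdot, hyy]
      have h1 := h.supporting j
      rw [← sub_add_sub_cancel _ (x p), dot_add, ← hs] at h1
      nlinarith
    · rw [hdot]
      have h1 := h.le j a b u ⟨fun hc => hj (hl j hc), h.corner_left, h.corner_right, h.ne, h.unit,
        h.perp, h.supporting⟩
      rw [← sub_add_sub_cancel (x j) (x p), dot_add] at h1
      have : 0 ≤ s * dot u (x j - x p) := mul_nonneg hpos.le (by linarith)
      linarith
  -- The length of any drop vector is the distance from `p` to the line of some edge, so it is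
  -- bounded below by minimality.
  · intro z hz
    obtain ⟨a', b', τ', hz'⟩ := DropVec.of_viewDrop hI hz
    obtain ⟨h1, h2⟩ := hz'.edgeData h.not_corner
    have h3 := h.le _ _ _ _ h1
    rw [h2, ← hs] at h3
    rw [hyy, dot_self_eq_norm_sq]
    gcongr

end Nearest

/-! ### Progress -/

/-- A monotone bounded sequence converges, so its increments tend to zero. -/
theorem exists_forall_lt_add {a : ℕ → ℝ} (hm : ∀ t, a t ≤ a (t + 1)) {B : ℝ} (hB : ∀ t, a t ≤ B)
    {d : ℝ} (hd : 0 < d) : ∃ T, ∀ t, T ≤ t → a (t + 1) < a t + d := by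
  have h1 := tendsto_atTop_ciSup (monotone_nat_of_le_succ hm) ⟨B, by rintro _ ⟨t, rfl⟩; exact hB t⟩
  have h2 := ((Filter.tendsto_add_atTop_iff_nat 1).2 h1).sub h1
  rw [sub_self] at h2
  obtain ⟨T, hT⟩ := Filter.eventually_atTop.1 (h2.eventually (gt_mem_nhds hd))
  exact ⟨T, fun t ht => by linarith [hT t ht]⟩

/-- A run, from some time on, in which the set `K` of corners is constant, all corners are lit and
none is red. -/
structure StableRun {n : ℕ} (δ : ℝ) (act : ℕ → Set (Fin n)) (x : ℕ → Fin n → Plane)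
    (c : ℕ → Fin n → Fin 5) (K : Set (Fin n)) : Prop where
  pos : 0 < δ
  inv : ∀ t, ConfigInv (x t) (c t)
  step : ∀ t, Step δ (act t) (x t) (c t) (x (t + 1)) (c (t + 1))
  fair : ∀ i t, ∃ s, t ≤ s ∧ i ∈ act s
  corner : ∀ t i, Corner (x t) i ↔ i ∈ K
  lit : ∀ t i, Lit (c t i) ↔ i ∈ K
  not_red : ∀ t i, c t i ≠ 1

namespace StableRun

variable {n : ℕ} {δ : ℝ} {act : ℕ → Set (Fin n)} {x : ℕ → Fin n → Plane} {c : ℕ → Fin n → Fin 5}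
  {K : Set (Fin n)}

theorem shift (R : StableRun δ act x c K) (m : ℕ) :
    StableRun δ (fun t => act (m + t)) (fun t => x (m + t)) (fun t => c (m + t)) K where
  pos := R.pos
  inv t := R.inv _
  step t := R.step _
  fair i t := by
    obtain ⟨s, hs, h⟩ := R.fair i (m + t)
    exact ⟨s - m, by omega, by rwa [Nat.add_sub_cancel' (by omega)]⟩
  corner t := R.corner _
  lit t := R.lit _
  not_red t := R.not_red _

theorem displacement (R : StableRun δ act x c K) (t : ℕ) (i : Fin n) :
    Displacement δ (x t) (c t) i (x (t + 1) i - x t i) :=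
  (R.step t).displacement R.pos (R.inv t) i

theorem not_mem_of_corner_eq (R : StableRun δ act x c K) {t : ℕ} {k : Fin n}
    (h : ¬ Corner (x t) k) (h' : Corner (x (t + 1)) k) : False :=
  h ((R.corner t k).2 ((R.corner _ k).1 h'))

/-- An active inner agent steps off the line, and any move off the line creates a new corner. Until
then nothing changes, so the induction is on the waiting time of `q`. -/
theorem not_flat (R : StableRun δ act x c K) {q : Fin n} (hq : q ∉ K) (t : ℕ) : ¬ Flat (x t) := by
  have key : ∀ k t, q ∈ act (t + k) → ¬ Flat (x t) := by
    intro k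
    induction k with
    | zero =>
      intro t ha hf
      have hqc : ¬ Corner (x t) q := fun h => hq ((R.corner t q).1 h)
      obtain ⟨y, hv, hr⟩ := (R.step t q).2 ha
      obtain ⟨s, hs, -, e, -⟩ := hv.pos R.pos
      obtain ⟨w, hw, hl⟩ := hf
      have hl' : ViewLine (relView (x t) (c t) q) w := (viewLine_iff (R.inv t).inj q w).2 ⟨hw, hl q⟩
      have hy : y ≠ 0 := by
        have hq1 : ¬ Lit (c t q) := mt (R.lit t q).1 hq
        generalize c t q = cq at hr hq1
        generalize c (t + 1) q = cq' at hr
        cases hr with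
        | red => exact absurd (Or.inl rfl) hq1
        | finish _ => exact absurd (Or.inr rfl) hq1
        | slide => exact absurd (Or.inr rfl) hq1
        | wait => exact absurd (Or.inr rfl) hq1
        | light _ _ h => exact absurd ((viewCorner_iff (R.inv t).inj q).1 h) hqc
        | leaveLine _ y _ _ h => exact h.1
        | drop _ y _ _ h => exact absurd ⟨w, hl'⟩ h
        | idle _ _ _ h => exact absurd ⟨w, hl'⟩ h
      have hne : x (t + 1) q ≠ x t q := by
        intro h0
        rw [h0, sub_self] at e
        exact smul_ne_zero hs.ne' hy e.symm
      obtain ⟨k, h1, h2⟩ := Flat.exists_new_corner (R.inv t).inj ⟨w, hw, hl⟩ (R.displacement t) hne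
      exact R.not_mem_of_corner_eq h1 h2
    | succ k ih =>
      intro t ha hf
      by_cases hm : ∃ p, x (t + 1) p ≠ x t p
      · obtain ⟨p, hp⟩ := hm
        obtain ⟨k, h1, h2⟩ := Flat.exists_new_corner (R.inv t).inj hf (R.displacement t) hp
        exact R.not_mem_of_corner_eq h1 h2
      · push Not at hm
        refine ih (t + 1) (by rwa [add_right_comm, add_assoc]) ?_
        rwa [funext hm]
  obtain ⟨s, hs, h⟩ := R.fair q t
  exact key (s - t) t (by rwa [Nat.add_sub_cancel' hs])

theorem le_dot (R : StableRun δ act x c K) {q : Fin n} (hq : q ∉ K) {t : ℕ} {u o : Plane}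
    (h : ∀ j, 0 ≤ dot u (x t j - o)) (j : Fin n) : 0 ≤ dot u (x (t + 1) j - o) :=
  le_dot_of_displacement (R.inv t).inj (R.not_flat hq t) (R.displacement t) u o h j

/-- A lit corner sees an agent that is no corner, on a common edge with it, so it is about to move. -/
theorem slides (R : StableRun δ act x c K) {t : ℕ} {a b : Fin n} {u : Plane} (ha : a ∈ K)
    (hact : a ∈ act t) (hb : b ∉ K) (hu : u ≠ 0) (hub : dot u (x t b - x t a) = 0)
    (hu0 : ∀ j, 0 ≤ dot u (x t j - x t a)) : False := by
  have hx := (R.inv t).inj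
  have hf := R.not_flat hb t
  have hab : b ≠ a := by rintro rfl; exact hb ha
  have hac : Corner (x t) a := (R.corner t a).2 ha
  obtain ⟨e, hea, hev, θ, hθ, hθ1, he⟩ := exists_visible_toward hx hab
  -- A corner cannot lie strictly between `a` and `b`, so the first agent towards `b` is unlit.
  have heK : e ∉ K := by
    intro heK
    have hne : e ≠ b := by rintro rfl; exact hb heK
    refine ((R.corner t e).2 heK).notMem_segment hea hne ?_
    rw [segment_eq_image']
    exact ⟨θ, ⟨hθ.le, hθ1⟩, by simp [← he]⟩
  have hel : ¬ Lit (c t e) := mt (R.lit t e).1 heK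
  -- An edge at `a` that avoids `e` is available for the slide.
  obtain ⟨f, w, hfa, hfv, hw, hwf, hw0, hwe⟩ := hac.exists_edge_not_on hx hf hea
  have hw' : w ≠ 0 := by rintro rfl; rw [dot_zero] at hw; exact zero_ne_one hw
  have hfe : e ≠ f := by rintro rfl; exact hwe.ne' hwf
  have hD := dot_self_pos (a := x t f - x t a) (fun h => hfa (hx (sub_eq_zero.1 h)))
  obtain ⟨r, hr, hshort⟩ : ∃ r : ℝ, 0 < r ∧ ∀ j, 0 < dot (x t f - x t a) (x t j - x t a) →
      2 * r * dot (x t f - x t a) (x t f - x t a) < dot (x t f - x t a) (x t j - x t a) := by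
    have key : ∀ j, ∀ᶠ r : ℝ in nhdsWithin 0 (Set.Ioi 0),
        0 < dot (x t f - x t a) (x t j - x t a) →
        2 * r * dot (x t f - x t a) (x t f - x t a) < dot (x t f - x t a) (x t j - x t a) := by
      intro j
      by_cases hj : 0 < dot (x t f - x t a) (x t j - x t a)
      · have h1 : Continuous fun r : ℝ => 2 * r * dot (x t f - x t a) (x t f - x t a) := by fun_prop
        have h2 := h1.tendsto 0
        simp only [mul_zero, zero_mul] at h2
        filter_upwards [(h2.mono_left nhdsWithin_le_nhds).eventually (gt_mem_nhds hj)] with r hr _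
        exact hr
      · exact Filter.Eventually.of_forall fun _ h => absurd h hj
    obtain ⟨r, hr, hr0⟩ := ((Filter.eventually_all.2 key).and self_mem_nhdsWithin).exists
    exact ⟨r, hr0, hr⟩
  have hview : ViewSlide (relView (x t) (c t) a) (r • (x t f - x t a)) := by
    simp only [ViewSlide, exists_relView, forall_relView]
    refine ⟨e, hev, f, hfv, hel, (viewEdge_iff hx hea).2 ⟨u, hu, ?_, hu0⟩,
      (viewEdge_iff hx hfa).2 ⟨w, hw', hwf, hw0⟩, fun h => hfe (hx (sub_left_injective h)), r, hr,
      rfl, fun j _ => hshort j⟩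
    rw [he, dot_smul, hub, mul_zero]
  obtain ⟨y, hv, hrule⟩ := (R.step t a).2 hact
  have hslide : ViewSlide (relView (x t) (c t) a) y := by
    have h1 : Lit (c t a) := (R.lit t a).2 ha
    have h2 := R.not_red t a
    have h3 : ¬ ∀ q ∈ relView (x t) (c t) a, Lit q.2 := by
      rw [forall_relView]
      exact fun h => hel (h e hev)
    generalize c t a = ca at hrule h1 h2
    generalize c (t + 1) a = ca' at hrule
    cases hrule with
    | red => exact absurd rfl h2
    | finish h => exact absurd h h3
    | slide y _ h => exact h
    | wait _ h => exact absurd ⟨_, hview⟩ h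
    | light _ h => exact absurd h1 h
    | leaveLine _ y h => exact absurd h1 h
    | drop _ y h => exact absurd h1 h
    | idle _ h => exact absurd h1 h
  obtain ⟨e', f', r', hs⟩ := SlideMove.of_viewSlide R.pos (R.inv t) hac hslide hv
  have he' : ¬ Corner (x t) e' := fun h => hs.unlit ((R.lit t e').2 ((R.corner t e').1 h))
  exact R.not_mem_of_corner_eq he' (hs.exposes hx hf (R.displacement t) he')

/-- A non-corner that is not interior shares a supporting line with a corner. Both rest until this
corner is activated, and the line keeps supporting the shrinking hull; then the corner slides and
exposes a new corner. -/
theorem interior (R : StableRun δ act x c K) {b : Fin n} (hb : b ∉ K) (t : ℕ) :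
    Interior (x t) b := by
  have key : ∀ (a : Fin n) (u : Plane), a ∈ K → u ≠ 0 → ∀ k t, a ∈ act (t + k) →
      dot u (x t b - x t a) = 0 → (∀ j, 0 ≤ dot u (x t j - x t a)) → False := by
    intro a u ha hu k
    induction k with
    | zero => exact fun t hact h1 h2 => R.slides ha hact hb hu h1 h2
    | succ k ih =>
      intro t hact h1 h2
      by_cases hat : a ∈ act t
      · exact R.slides ha hat hb hu h1 h2
      have hxa : x (t + 1) a = x t a := ((R.step t a).1 hat).1
      have hbc : ¬ Corner (x t) b := mt (R.corner t b).1 hb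
      have hxb : x (t + 1) b = x t b := by
        cases R.displacement t b with
        | stay h => exact sub_eq_zero.1 h
        | slide e f r h => exact absurd h.corner hbc
        | leaveLine _ h3 h4 => exact absurd (Flat.of_dot_eq_zero h3 h4) (R.not_flat hb t)
        | drop _ _ _ _ _ _ h => exact absurd h1 (h.dot_pos hu h2).ne'
      refine ih (t + 1) (by rwa [add_right_comm, add_assoc]) (by rw [hxa, hxb, h1]) fun j => ?_
      rw [hxa]
      exact R.le_dot hb h2 j
  intro u hu
  by_contra! h
  obtain ⟨a, hac, hmin⟩ := exists_corner_minimizing (R.inv t).inj u hu b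
  have h1 := h a
  have h2 := hmin b
  have h3 : dot u (x t a) = dot u (x t b) := by
    rw [dot_sub] at h1
    linarith
  obtain ⟨s, hs, hact⟩ := R.fair a t
  refine key a u ((R.corner t a).1 hac) hu (s - t) t (by rwa [Nat.add_sub_cancel' hs]) ?_ fun j => ?_
  · rw [dot_sub, h3, sub_self]
  · rw [dot_sub]
    linarith [hmin j]

/-- A slide requires an unlit agent on the boundary, and none is left. -/
theorem corner_pos_succ (R : StableRun δ act x c K) {q : Fin n} (hq : q ∉ K) (t : ℕ) {i : Fin n}
    (hi : i ∈ K) : x (t + 1) i = x t i := by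
  cases R.displacement t i with
  | stay h => exact sub_eq_zero.1 h
  | slide e f r h =>
    obtain ⟨u, hu, h1, h2⟩ := h.edge_left
    exact absurd h1 ((R.interior (mt (R.lit t e).2 h.unlit) t).dot_pos hu h2).ne'
  | leaveLine _ h3 h4 => exact absurd (Flat.of_dot_eq_zero h3 h4) (R.not_flat hq t)
  | drop _ _ _ _ _ h => exact absurd ((R.corner t i).2 hi) h

/-- An agent that is no corner and moves does not reach its destination, so it moves by at
least `δ`. -/
theorem drop_of_ne (R : StableRun δ act x c K) (t : ℕ) {p : Fin n} (hp : p ∉ K)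
    (hm : x (t + 1) p ≠ x t p) : ∃ (a b : Fin n) (τ : ℝ) (y : Plane) (s : ℝ), DropVec (x t) p a b τ y ∧
      x (t + 1) p - x t p = s • y ∧ 0 < s ∧ δ ≤ ‖x (t + 1) p - x t p‖ ∧
      ViewBestDrop (relView (x t) (c t) p) y := by
  cases R.displacement t p with
  | stay h => exact absurd (sub_eq_zero.1 h) hm
  | slide _ _ _ h => exact absurd ((R.corner t p).1 h.corner) hp
  | leaveLine _ h3 h4 => exact absurd (Flat.of_dot_eq_zero h3 h4) (R.not_flat hp t)
  | drop a b τ y s _ _ h hs0 hs1 e hδ hbest =>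
    refine ⟨a, b, τ, y, s, h, e, hs0, hδ.resolve_left ?_, hbest⟩
    -- A completed drop would end on a line that supports the new hull as well, contradicting
    -- interiority.
    rintro rfl
    rw [one_smul] at e
    obtain ⟨k, hk⟩ := R.interior hp (t + 1) (-y) (neg_ne_zero.2 h.ne_zero)
    refine absurd (R.le_dot hp (fun j => ?_) k) (not_le.2 hk)
    rw [neg_dot, ← sub_add_cancel (x (t + 1) p) (x t p), e, sub_add_eq_sub_sub_swap, dot_sub]
    linarith [h.supporting j]

/-- The sum of the squared distances between the agents in `N`. -/
noncomputable def spread (N : Finset (Fin n)) (z : Fin n → Plane) : ℝ :=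
  ∑ p ∈ N, ∑ q ∈ N, dot (z q - z p) (z q - z p)

theorem pair_le (R : StableRun δ act x c K) (t : ℕ) {p q : Fin n} (hp : p ∉ K) (hq : q ∉ K) :
    dot (x t q - x t p) (x t q - x t p) +
      dot ((x (t + 1) q - x t q) - (x (t + 1) p - x t p))
        ((x (t + 1) q - x t q) - (x (t + 1) p - x t p)) ≤
      dot (x (t + 1) q - x (t + 1) p) (x (t + 1) q - x (t + 1) p) :=
  dist_le_of_displacement (R.not_flat hp t) (R.displacement t) (mt (R.corner t p).1 hp)
    (mt (R.corner t q).1 hq)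

theorem spread_add_le (R : StableRun δ act x c K) {N : Finset (Fin n)} (hN : ∀ p ∈ N, p ∉ K) (t : ℕ)
    {p q : Fin n} (hp : p ∈ N) (hq : q ∈ N) :
    spread N (x t) + dot ((x (t + 1) q - x t q) - (x (t + 1) p - x t p))
        ((x (t + 1) q - x t q) - (x (t + 1) p - x t p)) ≤ spread N (x (t + 1)) := by
  have h0 : ∀ p' ∈ N, ∀ q' ∈ N,
      0 ≤ dot (x (t + 1) q' - x (t + 1) p') (x (t + 1) q' - x (t + 1) p') -
        dot (x t q' - x t p') (x t q' - x t p') := by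
    intro p' hp' q' hq'
    have := R.pair_le t (hN p' hp') (hN q' hq')
    linarith [dot_self_nonneg ((x (t + 1) q' - x t q') - (x (t + 1) p' - x t p'))]
  have h1 := Finset.single_le_sum (fun p' hp' => Finset.sum_nonneg (h0 p' hp')) hp
  have h2 := Finset.single_le_sum (h0 p hp) hq
  have h3 := R.pair_le t (hN p hp) (hN q hq)
  simp only [Finset.sum_sub_distrib] at h1 h2
  unfold spread
  linarith

/-- Half-planes that contain the initial agents contain them forever; four of them enclose a square
of side `2 * M`. -/
theorem exists_spread_le (R : StableRun δ act x c K) (N : Finset (Fin n)) {q : Fin n}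
    (hq : q ∉ K) : ∃ B, ∀ t, spread N (x t) ≤ B := by
  obtain ⟨M, hM⟩ : ∃ M : ℝ, ∀ j, ‖x 0 j‖ ≤ M := by
    obtain ⟨j, -, h⟩ := Finset.univ.exists_max_image (fun j => ‖x 0 j‖) ⟨q, Finset.mem_univ _⟩
    exact ⟨_, fun i => h i (Finset.mem_univ _)⟩
  have key : ∀ u o : Plane, (∀ j, 0 ≤ dot u (x 0 j - o)) → ∀ t j, 0 ≤ dot u (x t j - o) := by
    intro u o h t
    induction t with
    | zero => exact h
    | succ t ih => exact R.le_dot hq ih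
  have hb : ∀ u : Plane, ∀ t j, -(‖u‖ * M) ≤ dot u (x t j) := by
    intro u t j
    by_cases hu : u = 0
    · simp [hu, dot]
    have h1 := dot_self_pos hu
    have h2 : ∀ z, dot u (z - (-(‖u‖ * M) / dot u u) • u) = dot u z + ‖u‖ * M := by
      intro z
      rw [dot_sub, dot_smul, div_mul_cancel₀ _ h1.ne']
      ring
    have h3 := key u ((-(‖u‖ * M) / dot u u) • u) (fun j => by
      rw [h2, dot_eq_inner]
      have h4 := abs_le.1 (abs_real_inner_le_norm u (x 0 j))
      have h5 := mul_le_mul_of_nonneg_left (hM j) (norm_nonneg u)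
      linarith) t j
    rw [h2] at h3
    linarith
  have hd : ∀ t i j, dot (x t i - x t j) (x t i - x t j) ≤ 2 * (2 * M * (2 * M)) := by
    intro t i j
    have e0 : ‖(!₂[1, 0] : Plane)‖ = 1 := by simp [EuclideanSpace.norm_eq]
    have e1 : ‖(!₂[0, 1] : Plane)‖ = 1 := by simp [EuclideanSpace.norm_eq]
    have c0 : ∀ z : Plane, dot !₂[1, 0] z = z 0 := fun z => by simp [dot]
    have c1 : ∀ z : Plane, dot !₂[0, 1] z = z 1 := fun z => by simp [dot]
    have h : ∀ k, |x t k 0| ≤ M ∧ |x t k 1| ≤ M := by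
      intro k
      have a0 := hb !₂[1, 0] t k
      have a1 := hb !₂[0, 1] t k
      have a2 := hb (-!₂[1, 0]) t k
      have a3 := hb (-!₂[0, 1]) t k
      rw [norm_neg, neg_dot] at a2 a3
      rw [e0, c0] at a0 a2
      rw [e1, c1] at a1 a3
      exact ⟨abs_le.2 ⟨by linarith, by linarith⟩, abs_le.2 ⟨by linarith, by linarith⟩⟩
    have key : ∀ a b : ℝ, |a| ≤ M → |b| ≤ M → (a - b) * (a - b) ≤ 2 * M * (2 * M) := by
      intro a b ha hb
      rw [abs_le] at ha hb
      nlinarith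
    have h0 := key _ _ (h i).1 (h j).1
    have h1 := key _ _ (h i).2 (h j).2
    simp only [dot, PiLp.sub_apply]
    linarith
  exact ⟨∑ p ∈ N, ∑ q ∈ N, 2 * (2 * M * (2 * M)),
    fun t => Finset.sum_le_sum fun p _ => Finset.sum_le_sum fun q _ => hd t q p⟩

/-- Eventually all agents that are no corners move in the same rounds. -/
theorem eventually_all_or_none (R : StableRun δ act x c K) {q : Fin n} (hq : q ∉ K) :
    ∃ T, ∀ t, T ≤ t → ∀ p p', p ∉ K → p' ∉ K → x (t + 1) p ≠ x t p → x (t + 1) p' ≠ x t p' := by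
  obtain ⟨N, hN⟩ : ∃ N : Finset (Fin n), ∀ p, p ∈ N ↔ p ∉ K := ⟨Kᶜ.toFinite.toFinset, by simp⟩
  have hN' : ∀ p ∈ N, p ∉ K := fun p => (hN p).1
  obtain ⟨B, hB⟩ := R.exists_spread_le N hq
  have hm : ∀ t, spread N (x t) ≤ spread N (x (t + 1)) := by
    intro t
    have := R.spread_add_le hN' t ((hN q).2 hq) ((hN q).2 hq)
    linarith [dot_self_nonneg ((x (t + 1) q - x t q) - (x (t + 1) q - x t q))]
  have hδ := R.pos
  obtain ⟨T, hT⟩ := exists_forall_lt_add hm hB (pow_pos hδ 2)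
  refine ⟨T, fun t ht p p' hp hp' h1 h2 => ?_⟩
  -- While `p'` rests, `p` moves by at least `δ`, so the spread gains `δ ^ 2`.
  have h3 := R.spread_add_le hN' t ((hN p').2 hp') ((hN p).2 hp)
  obtain ⟨_, _, _, _, _, -, -, -, h4, -⟩ := R.drop_of_ne t hp h1
  rw [h2, sub_self, sub_zero, dot_self_eq_norm_sq] at h3
  have h5 := hT t ht
  have h6 : δ ^ 2 ≤ ‖x (t + 1) p - x t p‖ ^ 2 := by gcongr
  linarith

/-- Some agent that is no corner has distance at most `γ` from an edge of the hull. -/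
def Near (z : Fin n → Plane) (γ : ℝ) : Prop :=
  ∃ p a b u, EdgeData z p a b u ∧ dot u (z p - z a) ≤ γ

/-- The executed drop may aim at another edge than the given one, but being shortest it starts no
farther away, and its edge rests because corners do. -/
theorem near_of_move (R : StableRun δ act x c K) {t : ℕ} {p a b : Fin n} {u : Plane}
    (h : NearestData (x t) p a b u) (hm : x (t + 1) p ≠ x t p) :
    Near (x (t + 1)) (dot u (x t p - x t a) - δ) := by
  have hp : p ∉ K := fun hp => h.not_corner ((R.corner t p).2 hp)
  have hint : ∀ i, ¬ Corner (x t) i → Interior (x t) i :=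
    fun i hi => R.interior (mt (R.corner t i).2 hi) t
  obtain ⟨y', hy', e'⟩ := h.exists_bestDrop (R.inv t) (R.not_flat hp t) hint
    (fun i hi => (R.lit t i).2 ((R.corner t i).1 hi))
  obtain ⟨a', b', τ, y, s, hd, e, hs, hδ, hbest⟩ := R.drop_of_ne t hp hm
  have h1 := hbest.2 y' hy'.1
  rw [dot_self_eq_norm_sq, dot_self_eq_norm_sq, sq_le_sq₀ (norm_nonneg _) (norm_nonneg _), e'] at h1
  obtain ⟨h2, h3⟩ := hd.edgeData h.not_corner
  have ha := R.corner_pos_succ hp t ((R.corner t a').1 h2.corner_left)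
  have hb := R.corner_pos_succ hp t ((R.corner t b').1 h2.corner_right)
  refine ⟨p, a', b', -(‖y‖⁻¹ • y), ⟨?_, ?_, ?_, h2.ne, h2.unit, ?_, fun j => ?_⟩, ?_⟩
  · exact mt (R.corner _ p).1 hp
  · exact (R.corner _ a').2 ((R.corner t a').1 h2.corner_left)
  · exact (R.corner _ b').2 ((R.corner t b').1 h2.corner_right)
  · rw [ha, hb]; exact h2.perp
  · rw [ha]; exact R.le_dot hp h2.supporting j
  · rw [ha, ← sub_add_sub_cancel _ (x t p), dot_add, h3, e, dot_smul, neg_dot, smul_dot,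
      dot_self_eq_norm_sq]
    rw [e, norm_smul, Real.norm_of_nonneg hs.le] at hδ
    have hy := norm_pos_iff.2 hd.ne_zero
    have h4 : s * -(‖y‖⁻¹ * ‖y‖ ^ 2) = -(s * ‖y‖) := by field_simp
    rw [h4]
    linarith

theorem moves_of_nearest (R : StableRun δ act x c K) {t : ℕ} {p a b : Fin n} {u : Plane}
    (h : NearestData (x t) p a b u) (hact : p ∈ act t) : x (t + 1) p ≠ x t p := by
  have hp : p ∉ K := fun hp => h.not_corner ((R.corner t p).2 hp)
  have hx := (R.inv t).inj
  have hf := R.not_flat hp t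
  have hint := R.interior hp t
  obtain ⟨y', hy', e'⟩ := h.exists_bestDrop (R.inv t) hf
    (fun i hi => R.interior (mt (R.corner t i).2 hi) t)
    (fun i hi => (R.lit t i).2 ((R.corner t i).1 hi))
  obtain ⟨y, hv, hr⟩ := (R.step t p).2 hact
  obtain ⟨s, hs, -, e, -⟩ := hv.pos R.pos
  have hy : y ≠ 0 := by
    have h1 : ¬ Lit (c t p) := mt (R.lit t p).1 hp
    generalize c t p = ca at hr h1
    generalize c (t + 1) p = ca' at hr
    cases hr with
    | red => exact absurd (Or.inl rfl) h1
    | finish _ => exact absurd (Or.inr rfl) h1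
    | slide => exact absurd (Or.inr rfl) h1
    | wait => exact absurd (Or.inr rfl) h1
    | light _ _ h2 => exact absurd ((viewCorner_iff hx p).1 h2) h.not_corner
    | leaveLine _ y _ _ h2 => exact h2.1
    | drop _ y _ _ _ _ h2 => exact h2.1.1
    | idle _ _ _ _ h2 => exact absurd ⟨(viewInterior_iff hx p).2 hint, y', hy'⟩ h2
  intro h0
  rw [h0, sub_self] at e
  exact smul_ne_zero hs.ne' hy e.symm

/-- By `hall` the whole configuration rests as long as the nearest agent does, so this agent is
still nearest when it moves. -/
theorem exists_near_sub (R : StableRun δ act x c K)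
    (hall : ∀ t p p', p ∉ K → p' ∉ K → x (t + 1) p ≠ x t p → x (t + 1) p' ≠ x t p')
    {t : ℕ} {γ : ℝ} (h : Near (x t) γ) : ∃ t', Near (x t') (γ - δ) := by
  obtain ⟨p₀, a₀, b₀, u₀, h, hγ⟩ := h
  obtain ⟨p, a, b, u, hnear, hle⟩ := h.exists_nearest (R.inv t).inj
  have hp : p ∉ K := fun hp => hnear.not_corner ((R.corner t p).2 hp)
  have key : ∀ k t, p ∈ act (t + k) → NearestData (x t) p a b u →
      ∃ t', Near (x t') (dot u (x t p - x t a) - δ) := by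
    intro k
    induction k with
    | zero => exact fun t hact h => ⟨t + 1, R.near_of_move h (R.moves_of_nearest h hact)⟩
    | succ k ih =>
      intro t hact h
      by_cases hm : x (t + 1) p = x t p
      · have hstay : x (t + 1) = x t := by
          funext i
          by_cases hi : i ∈ K
          · exact R.corner_pos_succ hp t hi
          · by_contra h1
            exact hall t i p hi hp h1 hm
        have := ih (t + 1) (by rwa [add_right_comm, add_assoc])
        rw [hstay] at this
        exact this h
      · exact ⟨t + 1, R.near_of_move h hm⟩
  obtain ⟨s, hs, hact⟩ := R.fair p t
  obtain ⟨t', _, a', b', u', h1, h2⟩ := key (s - t) t (by rwa [Nat.add_sub_cancel' hs]) hnear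
  exact ⟨t', _, a', b', u', h1, by linarith⟩

/-- Repeated decreases by `δ` would make the distance of an interior agent from an edge nonpositive.
-/
theorem forall_mem (R : StableRun δ act x c K) (q : Fin n) : q ∈ K := by
  by_contra hq
  obtain ⟨T, hT⟩ := R.eventually_all_or_none hq
  have R' := R.shift T
  have hall : ∀ t p p', p ∉ K → p' ∉ K → x (T + (t + 1)) p ≠ x (T + t) p →
      x (T + (t + 1)) p' ≠ x (T + t) p' := fun t => hT (T + t) (by omega)
  obtain ⟨a, b, u, h⟩ := exists_edgeData (R'.inv 0).inj (R'.not_flat hq 0)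
    (fun i hi => R'.interior (mt (R'.corner 0 i).2 hi) 0) (mt (R'.corner 0 q).1 hq)
  obtain ⟨γ, hγ⟩ : ∃ γ, γ = dot u (x (T + 0) q - x (T + 0) a) := ⟨_, rfl⟩
  have key : ∀ m : ℕ, ∃ t, Near (x (T + t)) (γ - m * δ) := by
    intro m
    induction m with
    | zero => exact ⟨0, q, a, b, u, h, by simp [hγ]⟩
    | succ m ih =>
      obtain ⟨t, ht⟩ := ih
      obtain ⟨t', h⟩ := R'.exists_near_sub hall ht
      refine ⟨t', ?_⟩
      push_cast
      rwa [add_mul, one_mul, ← sub_sub]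
  obtain ⟨m, hm⟩ := exists_nat_ge (γ / δ)
  rw [div_le_iff₀ R.pos] at hm
  obtain ⟨t, p, a, b, u, h, hle⟩ := key m
  have hp : p ∉ K := fun hp => h.not_corner ((R.corner _ p).2 hp)
  have := (R.interior hp (T + t)).dot_pos h.ne_zero h.supporting
  linarith

end StableRun

/-! ### The main theorem -/

namespace SSYNCExecution

variable {n : ℕ} {δ : ℝ}

/-! ### Monotonicity of corners and lights along an execution -/

theorem configInv (E : SSYNCExecution convexAlgorithm 0 n δ) (hδ : 0 < δ) (t : ℕ) :
    ConfigInv (E.pos t) (E.col t) := by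
  induction t with
  | zero => exact ⟨E.init_pos, fun i h => by simp [E.init_col i, Lit] at h⟩
  | succ t ih => exact (E.step t).inv hδ ih

theorem corner_mono (E : SSYNCExecution convexAlgorithm 0 n δ) (hδ : 0 < δ) {i : Fin n} {s t : ℕ}
    (hst : s ≤ t) (h : Corner (E.pos s) i) : Corner (E.pos t) i := by
  induction t, hst using Nat.le_induction with
  | base => exact h
  | succ t _ ih => exact (E.step t).corner hδ (E.configInv hδ t) ih

theorem lit_succ (E : SSYNCExecution convexAlgorithm 0 n δ) {i : Fin n} {t : ℕ}
    (h : Lit (E.col t i)) : Lit (E.col (t + 1) i) := by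
  by_cases ha : i ∈ E.active t
  · obtain ⟨y, -, hr⟩ := (E.step t i).2 ha
    generalize E.col t i = c at hr h
    generalize E.col (t + 1) i = c' at hr
    cases hr with
    | red => exact h
    | finish _ => exact Or.inl rfl
    | slide => exact h
    | wait => exact h
    | light _ _ => exact Or.inr rfl
    | leaveLine _ _ h' => exact absurd h h'
    | drop _ _ h' => exact absurd h h'
    | idle _ h' => exact absurd h h'
  · rwa [E.idle_col t i ha]

theorem lit_mono (E : SSYNCExecution convexAlgorithm 0 n δ) {i : Fin n} {s t : ℕ} (hst : s ≤ t)
    (h : Lit (E.col s i)) : Lit (E.col t i) := by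
  induction t, hst using Nat.le_induction with
  | base => exact h
  | succ t _ ih => exact E.lit_succ ih

theorem lit_of_active (E : SSYNCExecution convexAlgorithm 0 n δ) (hδ : 0 < δ) {i : Fin n} {t : ℕ}
    (hc : Corner (E.pos t) i) (ha : i ∈ E.active t) : Lit (E.col (t + 1) i) := by
  have hc' := (viewCorner_iff (c := E.col t) (E.configInv hδ t).inj i).2 hc
  obtain ⟨y, -, hr⟩ := (E.step t i).2 ha
  generalize E.col t i = c at hr
  generalize E.col (t + 1) i = c' at hr
  cases hr with
  | red => exact Or.inl rfl
  | finish _ => exact Or.inl rfl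
  | slide => exact Or.inr rfl
  | wait => exact Or.inr rfl
  | light _ _ => exact Or.inr rfl
  | leaveLine _ _ _ h => exact absurd hc' h
  | drop _ _ _ h => exact absurd hc' h
  | idle _ _ h => exact absurd hc' h

/-- If all visible agents are lit, they are corners and hide nobody. This yields the detection of
termination. -/
theorem forall_of_forall_visible (E : SSYNCExecution convexAlgorithm 0 n δ) (hδ : 0 < δ) {i : Fin n}
    {t : ℕ} {P : Fin 5 → Prop} (hP : ∀ a, P a → Lit a)
    (h : ∀ j, Visible (E.pos t) i j → P (E.col t j)) (j : Fin n) : P (E.col t j) :=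
  have hI := E.configInv hδ t
  h j (visible_of_forall_visible_corner hI.inj (fun k hk => hI.corner k (hP _ (h k hk))) j)

/-- At the moment of turning red, the agent saw only lit agents, hence saw all agents; lights are
never switched off. -/
theorem forall_lit_of_red (E : SSYNCExecution convexAlgorithm 0 n δ) (hδ : 0 < δ) {i : Fin n}
    {t : ℕ} (h : E.col t i = 1) (j : Fin n) : Lit (E.col t j) := by
  induction t with
  | zero => simp [E.init_col] at h
  | succ t ih =>
    by_cases h1 : E.col t i = 1
    · exact E.lit_succ (ih h1)
    by_cases ha : i ∈ E.active t
    · obtain ⟨y, -, hr⟩ := (E.step t i).2 ha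
      refine E.lit_succ (E.forall_of_forall_visible hδ (P := Lit) (fun _ h => h) (i := i) ?_ j)
      have h2 : ∀ q ∈ relView (E.pos t) (E.col t) i, Lit q.2 := by
        have h0 : Lit 1 := Or.inl rfl
        generalize E.col t i = c at hr h1
        rw [h] at hr
        cases hr <;> first | assumption | exact absurd rfl h1
      rwa [forall_relView] at h2
    · rw [E.idle_col t i ha] at h
      exact absurd h h1

/-- Corners are never lost and there are finitely many agents, so `K` consists of those that are
ever a corner. -/
theorem eventually_corner_iff (E : SSYNCExecution convexAlgorithm 0 n δ) (hδ : 0 < δ) :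
    ∃ K : Set (Fin n), ∃ T, ∀ t, T ≤ t → ∀ i, Corner (E.pos t) i ↔ i ∈ K := by
  refine ⟨{i | ∃ t, Corner (E.pos t) i}, ?_⟩
  have key : ∀ i, ∀ᶠ t in Filter.atTop, Corner (E.pos t) i ↔ ∃ t, Corner (E.pos t) i := by
    intro i
    by_cases h : ∃ t, Corner (E.pos t) i
    · obtain ⟨s, hs⟩ := h
      filter_upwards [Filter.eventually_ge_atTop s] with t ht
      exact ⟨fun h => ⟨t, h⟩, fun _ => E.corner_mono hδ ht hs⟩
    · exact Filter.Eventually.of_forall fun t => ⟨fun h => ⟨t, h⟩, fun h' => absurd h' h⟩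
  exact Filter.eventually_atTop.1 (Filter.eventually_all.2 key)

theorem eventually_lit_of_corner (E : SSYNCExecution convexAlgorithm 0 n δ) (hδ : 0 < δ) (s : ℕ) :
    ∃ T, ∀ t, T ≤ t → ∀ i, Corner (E.pos s) i → Lit (E.col t i) := by
  have key : ∀ i, ∀ᶠ t in Filter.atTop, Corner (E.pos s) i → Lit (E.col t i) := by
    intro i
    by_cases h : Corner (E.pos s) i
    · obtain ⟨r, hr, ha⟩ := E.fair i s
      filter_upwards [Filter.eventually_ge_atTop (r + 1)] with t ht _
      exact E.lit_mono ht (E.lit_of_active hδ (E.corner_mono hδ hr h) ha)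
    · exact Filter.Eventually.of_forall fun t h' => absurd h' h
  exact Filter.eventually_atTop.1 (Filter.eventually_all.2 key)

theorem eventually_corner (E : SSYNCExecution convexAlgorithm 0 n δ) (hδ : 0 < δ) :
    ∃ T, ∀ i, Corner (E.pos T) i := by
  obtain ⟨K, T₁, h₁⟩ := E.eventually_corner_iff hδ
  obtain ⟨T₂, h₂⟩ := E.eventually_lit_of_corner hδ T₁
  by_contra! hno
  obtain ⟨T, hT⟩ : ∃ T, T = max T₁ T₂ := ⟨_, rfl⟩
  have hc : ∀ t i, Corner (E.pos (T + t)) i ↔ i ∈ K := fun t => h₁ _ (by omega)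
  have hl : ∀ t i, Lit (E.col (T + t) i) ↔ i ∈ K := fun t i =>
    ⟨fun h => (hc t i).1 ((E.configInv hδ _).corner i h),
      fun h => h₂ _ (by omega) i ((h₁ T₁ le_rfl i).2 h)⟩
  obtain ⟨q, hq⟩ := hno T
  have R : StableRun δ (fun t => E.active (T + t)) (fun t => E.pos (T + t))
      (fun t => E.col (T + t)) K :=
    { pos := hδ
      inv := fun t => E.configInv hδ _
      step := fun t => E.step _
      fair := fun i t => by
        obtain ⟨s, hs, h⟩ := E.fair i (T + t)
        exact ⟨s - T, by omega, by rwa [Nat.add_sub_cancel' (by omega)]⟩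
      corner := hc
      lit := hl
      -- One red agent would certify that all are lit, and so that `q` is a corner.
      not_red := fun t i h =>
        hq ((hc 0 q).2 ((hl t q).1 (E.forall_lit_of_red hδ h q))) }
  exact hq ((hc 0 q).2 (R.forall_mem q))

/-- Nobody has a reason to move any more, and green agents turn red when activated. -/
theorem red_or_idle_of_forall_lit (E : SSYNCExecution convexAlgorithm 0 n δ) {t : ℕ}
    (h : ∀ j, Lit (E.col t j)) (i : Fin n) : E.pos (t + 1) i = E.pos t i ∧
      (E.col (t + 1) i = 1 ∨ i ∉ E.active t ∧ E.col (t + 1) i = E.col t i) := by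
  by_cases ha : i ∈ E.active t
  · obtain ⟨y, ⟨s, -, -, e, -⟩, hr⟩ := (E.step t i).2 ha
    have h1 := h i
    have h2 : ∀ q ∈ relView (E.pos t) (E.col t) i, Lit q.2 := forall_relView.2 fun j _ => h j
    have h3 : y = 0 ∧ E.col (t + 1) i = 1 := by
      generalize E.col t i = c at hr h1
      generalize E.col (t + 1) i = c' at hr
      cases hr <;> first | exact ⟨rfl, rfl⟩ | contradiction
    rw [h3.1, smul_zero] at e
    exact ⟨sub_eq_zero.1 e, Or.inl h3.2⟩
  · exact ⟨E.idle_pos t i ha, Or.inr ⟨ha, E.idle_col t i ha⟩⟩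

theorem red_succ (E : SSYNCExecution convexAlgorithm 0 n δ) {i : Fin n} {t : ℕ}
    (h : E.col t i = 1) : E.col (t + 1) i = 1 := by
  by_cases ha : i ∈ E.active t
  · rw [E.step_col t i ha, h, convexAlgorithm_red]
  · rwa [E.idle_col t i ha]

theorem red_mono (E : SSYNCExecution convexAlgorithm 0 n δ) {i : Fin n} {s t : ℕ} (hst : s ≤ t)
    (h : E.col s i = 1) : E.col t i = 1 := by
  induction t, hst using Nat.le_induction with
  | base => exact h
  | succ t _ ih => exact E.red_succ ih

theorem eventually_final (E : SSYNCExecution convexAlgorithm 0 n δ) (hδ : 0 < δ) :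
    ∃ T, ∀ t, T ≤ t → E.pos t = E.pos T ∧ (∀ i, E.col t i = 1) ∧ ∀ i, Corner (E.pos t) i := by
  obtain ⟨T₁, h₁⟩ := E.eventually_corner hδ
  obtain ⟨T₂, h₂⟩ := E.eventually_lit_of_corner hδ T₁
  have hlit : ∀ t, T₂ ≤ t → ∀ i, Lit (E.col t i) := fun t ht i => h₂ t ht i (h₁ i)
  have key : ∀ i, ∀ᶠ t in Filter.atTop, E.col t i = 1 := by
    intro i
    obtain ⟨s, hs, ha⟩ := E.fair i T₂
    filter_upwards [Filter.eventually_ge_atTop (s + 1)] with t ht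
    refine E.red_mono ht ?_
    rcases (E.red_or_idle_of_forall_lit (hlit s hs) i).2 with h | h
    · exact h
    · exact absurd ha h.1
  obtain ⟨T₃, h₃⟩ := Filter.eventually_atTop.1 (Filter.eventually_all.2 key)
  refine ⟨max T₂ T₃, fun t ht => ⟨?_, h₃ t (by omega), fun i => ?_⟩⟩
  · induction t, ht using Nat.le_induction with
    | base => rfl
    | succ t ht ih =>
      rw [← ih]
      exact funext fun i => (E.red_or_idle_of_forall_lit (hlit t (by omega)) i).1
  · exact (E.configInv hδ t).corner i (hlit t (by omega) i)

end SSYNCExecution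

theorem mainTheorem1 :
    ∃ (A : Algorithm (Fin 5)) (black red : Fin 5),
      black ≠ red ∧
      -- local termination: an agent colored `red` never moves nor changes its color
      (∀ V : Set (Plane × Fin 5), A red V = (0, red)) ∧
      ∀ (n : ℕ) (δ : ℝ), 0 < δ → ∀ E : SSYNCExecution A black n δ,
        -- agents never collide
        (∀ t, Function.Injective (E.pos t)) ∧
        -- in finite time a final configuration is reached
        (∃ T, ∀ t, T ≤ t →
          E.pos t = E.pos T ∧
          (∀ i, E.col t i = red) ∧
          (∀ i, AtCorner (E.pos t) i) ∧
          ObstructionFree (E.pos t)) ∧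
        -- detection of global termination from the local view
        (∀ t i, E.col t i = red → (∀ j, Visible (E.pos t) i j → E.col t j = red) →
          ∀ j, E.col t j = red) := by
  refine ⟨convexAlgorithm, 0, 1, by decide, convexAlgorithm_red, fun n δ hδ E =>
    ⟨fun t => (E.configInv hδ t).inj, ?_, fun t i _ h =>
      E.forall_of_forall_visible hδ (P := fun a => a = 1) (fun _ => Or.inl) h⟩⟩
  obtain ⟨T, hT⟩ := E.eventually_final hδ
  refine ⟨T, fun t ht => ?_⟩
  obtain ⟨h1, h2, h3⟩ := hT t ht
  exact ⟨h1, h2, fun i => (h3 i).atCorner, obstructionFree_of_corners h3⟩
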